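/- Let $\Gamma$ be a countable discrete group acting measurably on a standard probability space $(X,\mu)$ so that $\mu$ is quasi-invariant: $\mu$ and $g.\mu$ have the same null sets for every $g\in\Gamma$. Let $\Gamma\times X$ carry the product of the counting measure and $\mu$, and let $L^\infty(X)$ and $L^\infty(\Gamma\times X)$ be the algebras of complex essentially bounded functions. For $g,h\in\Gamma$ and $x\in X$ put $(g.a)(x)=a(g^{-1}.x)$ for $a\in L^\infty(X)$ and $(g.\xi)(h,x)=\xi(g^{-1}h,g^{-1}.x)$ for $\xi\in L^\infty(\Gamma\times X)$. For $a\in L^\infty(X)$ let $(1_\Gamma\otimes a)(h,x)=a(x)$. A linear map $P:L^\infty(\Gamma\times X)\to L^\infty(X)$ is called unital if $P(1)=1$, $L^\infty(X)$-linear if $P((1_\Gamma\otimes a)\xi)=aP(\xi)$, $\Gamma$-equivariant if $P(g.\xi)=g.P(\xi)$, $*$-preserving if $P(\overline{\xi})=\overline{P(\xi)}$, and positive if $P(\xi)\ge 0$ whenever $\xi\ge 0$. For a finitely supported map $p:\Gamma\to L^\infty(X)$ put $(h.p)(g)=h.(p(h^{-1}g))$; a net $(P_i)_i$ of such maps is called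 bounded if $\sup_i\big\|\sum_{g\in\Gamma}|P_i(g)|\big\|_\infty<\infty$. Ultraweak convergence in $L^\infty(X)$ is convergence in the weak-$*$ topology $\sigma(L^\infty(X),L^1(X))$. The following are equivalent: 1. There exists a bounded, unital, $L^\infty(X)$-linear, $\Gamma$-equivariant linear map $P:L^\infty(\Gamma\times X)\to L^\infty(X)$. 2. There exists a bounded, $*$-preserving, unital, $L^\infty(X)$-linear, $\Gamma$-equivariant linear map $P:L^\infty(\Gamma\times X)\to L^\infty(X)$. 3. There exists a bounded net $(P_i)_i$ of finitely supported maps $P_i:\Gamma\to L^\infty(X)$ with (a) $\sum_{g\in\Gamma}P_i(g)\to 1_X$ ultraweakly, and (b) $\sum_{g\in\Gamma}\big((h.P_i)(g)-P_i(g)\big)f(g)\to 0$ ultraweakly for all $f\in L^\infty(\Gamma\times X)$ and $h\in\Gamma$, where $f(g)=f(g,\cdot)$. 4. There exists a bounded net $(P_i)_i$ of finitely supported maps $P_i:\Gamma\to L^\infty(X)$ satisfying (a) and (b) such that, for every $i$, $P_i(g)\ge 0$ for all $g\in\Gamma$ and $\sum_{g\in\Gamma}P_i(g)\le 1_X$.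 5. There exists a positive, unital, $L^\infty(X)$-linear, $\Gamma$-equivariant linear map $P:L^\infty(\Gamma\times X)\to L^\infty(X)$. Moreover, every positive, unital, $L^\infty(X)$-linear map $P:L^\infty(\Gamma\times X)\to L^\infty(X)$ (in particular every $P$ as in 5) is a conditional expectation onto $1_\Gamma\otimes L^\infty(X)\cong L^\infty(X)$: it is a positive, contractive, $L^\infty(X)$-linear map with $P(1_\Gamma\otimes a)=a$ for all $a\in L^\infty(X)$. -/

import Mathlib

open MeasureTheory Filter Topology
open scoped ENNReal ComplexOrder

universe u v

namespace MeasuredAction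

noncomputable section

/-- The space of complex essentially bounded functions modulo null sets. -/
abbrev LInf {α : Type*} [MeasurableSpace α] (ν : Measure α) : Type _ := Lp ℂ ∞ ν

/-- The unit of the algebra of essentially bounded functions: the constant function one. -/
def linfOne {α : Type*} [MeasurableSpace α] (ν : Measure α) : LInf ν :=
  (memLp_top_const (1 : ℂ)).toLp (fun _ => (1 : ℂ))

/-- The (pointwise) product of two essentially bounded functions. -/
def linfMul {α : Type*} [MeasurableSpace α] {ν : Measure α} (a b : LInf ν) : LInf ν := a • b

theorem coeFn_linfOne {α : Type*} [MeasurableSpace α] (ν : Measure α) :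
    (linfOne ν : α → ℂ) =ᵐ[ν] fun _ => 1 :=
  MemLp.coeFn_toLp _

theorem coeFn_linfMul {α : Type*} [MeasurableSpace α] {ν : Measure α} (a b : LInf ν) :
    (linfMul a b : α → ℂ) =ᵐ[ν] fun x => a x * b x :=
  Lp.coeFn_lpSMul a b

theorem memLp_top_comp {α β : Type*} [MeasurableSpace α] [MeasurableSpace β]
    {μ : Measure α} {ν : Measure β} {φ : α → β}
    (hφ : Measure.QuasiMeasurePreserving φ μ ν) (f : LInf ν) :
    MemLp (fun x => f (φ x)) ∞ μ := by
  have hb : ∀ᵐ y ∂ν, ‖f y‖ ≤ ‖f‖ := by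
    have h := ae_le_eLpNormEssSup (f := (f : β → ℂ)) (μ := ν)
    filter_upwards [h] with y hy
    rw [Lp.norm_def, eLpNorm_exponent_top, ← toReal_enorm]
    refine ENNReal.toReal_mono ?_ hy
    have := Lp.eLpNorm_ne_top f
    rwa [eLpNorm_exponent_top] at this
  exact memLp_top_of_bound ((Lp.aestronglyMeasurable f).comp_quasiMeasurePreserving hφ) ‖f‖
    (hφ.ae hb)

/-- Composition `f ∘ φ` of an essentially bounded function with a nonsingular map. -/
def linfComp {α β : Type*} [MeasurableSpace α] [MeasurableSpace β]
    {μ : Measure α} {ν : Measure β} (φ : α → β)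
    (hφ : Measure.QuasiMeasurePreserving φ μ ν) (f : LInf ν) : LInf μ :=
  (memLp_top_comp hφ f).toLp (fun x => f (φ x))

theorem coeFn_linfComp {α β : Type*} [MeasurableSpace α] [MeasurableSpace β]
    {μ : Measure α} {ν : Measure β} (φ : α → β)
    (hφ : Measure.QuasiMeasurePreserving φ μ ν) (f : LInf ν) :
    (linfComp φ hφ f : α → ℂ) =ᵐ[μ] fun x => f (φ x) :=
  MemLp.coeFn_toLp _

theorem linfComp_zero {α β : Type*} [MeasurableSpace α] [MeasurableSpace β]
    {μ : Measure α} {ν : Measure β} (φ : α → β)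
    (hφ : Measure.QuasiMeasurePreserving φ μ ν) : linfComp φ hφ (0 : LInf ν) = 0 := by
  apply Lp.ext
  filter_upwards [coeFn_linfComp φ hφ (0 : LInf ν), Lp.coeFn_zero ℂ ∞ μ,
    hφ.ae (Lp.coeFn_zero ℂ ∞ ν)] with x h1 h2 h3
  rw [h1, h2, h3]
  rfl

/-- Quasi-invariance of `μ`: for every group element `g`, the measures `g.μ` and `μ` have the same
null sets. -/
class QuasiInvariant (Γ : Type*) {X : Type*} [Group Γ] [MulAction Γ X] [MeasurableSpace X]
    (μ : Measure X) : Prop where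
  map_null_iff : ∀ (g : Γ) (s : Set X), μ.map (fun x => g • x) s = 0 ↔ μ s = 0

/-- The product of the counting measure on `Γ` and `μ`. -/
abbrev prodMeasure (Γ : Type u) {X : Type v} [MeasurableSpace Γ] [MeasurableSpace X]
    (μ : Measure X) : Measure (Γ × X) :=
  (Measure.count : Measure Γ).prod μ

theorem qmp_smul {Γ : Type u} {X : Type v} [Group Γ] [MeasurableSpace X] [MulAction Γ X]
    [MeasurableConstSMul Γ X] (μ : Measure X) [QuasiInvariant Γ μ] (g : Γ) :
    Measure.QuasiMeasurePreserving (fun x : X => g • x) μ μ :=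
  ⟨measurable_const_smul g, fun s hs => (QuasiInvariant.map_null_iff g s).2 hs⟩

theorem qmp_section {Γ : Type u} {X : Type v} [Countable Γ] [MeasurableSpace Γ]
    [DiscreteMeasurableSpace Γ] [MeasurableSpace X] (μ : Measure X) [IsProbabilityMeasure μ]
    (g : Γ) :
    Measure.QuasiMeasurePreserving (fun x : X => (g, x)) μ (prodMeasure Γ μ) := by
  refine ⟨measurable_prodMk_left, Measure.AbsolutelyContinuous.mk fun s hs h0 => ?_⟩
  rw [Measure.map_apply measurable_prodMk_left hs]
  have h := Measure.measure_ae_null_of_prod_null h0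
  have h' : ∀ k : Γ, μ (Prod.mk k ⁻¹' s) = 0 := by
    intro k
    by_contra hk
    have h1 : (Measure.count : Measure Γ) {k} ≤ 0 := by
      refine le_trans (measure_mono ?_) (le_of_eq (ae_iff.1 h))
      intro y hy
      rw [Set.mem_singleton_iff.1 hy]
      exact hk
    rw [Measure.count_singleton] at h1
    simp at h1
  exact h' g

theorem qmp_prod_smul {Γ : Type u} {X : Type v} [Group Γ] [Countable Γ] [MeasurableSpace Γ]
    [DiscreteMeasurableSpace Γ] [MeasurableSpace X] [MulAction Γ X] [MeasurableConstSMul Γ X]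
    (μ : Measure X) [IsProbabilityMeasure μ] [QuasiInvariant Γ μ] (g : Γ) :
    Measure.QuasiMeasurePreserving (fun p : Γ × X => (g * p.1, g • p.2))
      (prodMeasure Γ μ) (prodMeasure Γ μ) := by
  have hm : Measurable (fun p : Γ × X => (g * p.1, g • p.2)) :=
    ((Measurable.of_discrete (f := fun h : Γ => g * h)).comp measurable_fst).prodMk
      (measurable_snd.const_smul g)
  refine ⟨hm, Measure.AbsolutelyContinuous.mk fun s hs h0 => ?_⟩
  rw [Measure.map_apply hm hs, Measure.measure_prod_null (hm hs)]
  refine Eventually.of_forall fun h => ?_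
  exact ((qmp_section μ (g * h)).comp (qmp_smul μ g)).preimage_null h0

section Action

variable {Γ : Type u} {X : Type v} [Group Γ] [Countable Γ] [MeasurableSpace Γ]
  [DiscreteMeasurableSpace Γ] [MeasurableSpace X] [MulAction Γ X] [MeasurableConstSMul Γ X]
  (μ : Measure X) [IsProbabilityMeasure μ]

/-- The action of `Γ` on functions on `X`: `(g.a)(x) = a(g⁻¹.x)`. -/
def act [QuasiInvariant Γ μ] (g : Γ) (a : LInf μ) : LInf μ :=
  linfComp (fun x => g⁻¹ • x) (qmp_smul μ g⁻¹) a

theorem act_zero [QuasiInvariant Γ μ] (g : Γ) : act μ g (0 : LInf μ) = 0 :=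
  linfComp_zero _ _

/-- The action of `Γ` on functions on `Γ × X`: `(g.ξ)(h, x) = ξ(g⁻¹h, g⁻¹.x)`. -/
def actProd [QuasiInvariant Γ μ] (g : Γ) (ξ : LInf (prodMeasure Γ μ)) : LInf (prodMeasure Γ μ) :=
  linfComp (fun p => (g⁻¹ * p.1, g⁻¹ • p.2)) (qmp_prod_smul μ g⁻¹) ξ

variable (Γ) in
/-- The embedding `a ↦ 1_Γ ⊗ a`, that is `(1_Γ ⊗ a)(h, x) = a(x)`. -/
def emb (a : LInf μ) : LInf (prodMeasure Γ μ) :=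
  linfComp (fun p : Γ × X => p.2) Measure.quasiMeasurePreserving_snd a

/-- The value at `g` of a function on `Γ × X`: `(sec g ξ)(x) = ξ(g, x)`. -/
def sec (g : Γ) (ξ : LInf (prodMeasure Γ μ)) : LInf μ :=
  linfComp (fun x => (g, x)) (qmp_section μ g) ξ

variable {μ}

/-- `P(1) = 1`. -/
def IsUnital (P : LInf (prodMeasure Γ μ) → LInf μ) : Prop :=
  P (linfOne (prodMeasure Γ μ)) = linfOne μ

/-- `P((1_Γ ⊗ a) ξ) = a P(ξ)`. -/
def IsModuleMap (P : LInf (prodMeasure Γ μ) → LInf μ) : Prop :=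
  ∀ (a : LInf μ) (ξ : LInf (prodMeasure Γ μ)), P (linfMul (emb Γ μ a) ξ) = linfMul a (P ξ)

/-- `P(g.ξ) = g.P(ξ)`. -/
def IsEquivariant [QuasiInvariant Γ μ] (P : LInf (prodMeasure Γ μ) → LInf μ) : Prop :=
  ∀ (g : Γ) (ξ : LInf (prodMeasure Γ μ)), P (actProd μ g ξ) = act μ g (P ξ)

/-- `P(ξ*) = P(ξ)*`, where the involution is pointwise complex conjugation. -/
def IsStarPreserving (P : LInf (prodMeasure Γ μ) → LInf μ) : Prop :=
  ∀ ξ : LInf (prodMeasure Γ μ), P (star ξ) = star (P ξ)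

/-- `P` maps (a.e.) nonnegative functions to (a.e.) nonnegative functions. -/
def IsPositive (P : LInf (prodMeasure Γ μ) → LInf μ) : Prop :=
  ∀ ξ : LInf (prodMeasure Γ μ), 0 ≤ ξ → 0 ≤ P ξ

/-- `P` is a conditional expectation onto `1_Γ ⊗ L^∞(X)`, identified with `L^∞(X)`: a positive,
contractive `L^∞(X)`-linear map that restricts to the identity. -/
structure IsConditionalExpectation (P : LInf (prodMeasure Γ μ) → LInf μ) : Prop where
  emb_eq : ∀ a : LInf μ, P (emb Γ μ a) = a
  positive : IsPositive P
  contractive : ∀ ξ : LInf (prodMeasure Γ μ), ‖P ξ‖ ≤ ‖ξ‖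
  module_map : IsModuleMap P

/-- The action of `Γ` on finitely supported maps: `(h.p)(g) = h.(p(h⁻¹g))`. -/
def actFin [QuasiInvariant Γ μ] (h : Γ) (p : Γ →₀ LInf μ) : Γ →₀ LInf μ :=
  (Finsupp.equivMapDomain (Equiv.mulLeft h) p).mapRange (act μ h) (act_zero μ h)

theorem actFin_apply [QuasiInvariant Γ μ] (h : Γ) (p : Γ →₀ LInf μ) (g : Γ) :
    actFin h p g = act μ h (p (h⁻¹ * g)) := by
  rw [actFin, Finsupp.mapRange_apply, Finsupp.equivMapDomain_apply]
  rfl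

/-- `∑_g p(g)`. -/
def total (p : Γ →₀ LInf μ) : LInf μ := p.sum fun _ a => a

/-- `∑_g p(g) f(g)`. -/
def pairing (p : Γ →₀ LInf μ) (f : LInf (prodMeasure Γ μ)) : LInf μ :=
  p.sum fun g a => linfMul a (sec μ g f)

/-- Boundedness of a family of finitely supported maps with respect to the norm
`‖∑_g |p(g)|‖_∞`, which is the norm of the operator `f ↦ ∑_g p(g) f(g)`. -/
def IsBoundedFamily {I : Type*} (p : I → Γ →₀ LInf μ) : Prop :=
  ∃ C : ℝ, ∀ i, ∀ᵐ x ∂μ, ∑ g ∈ (p i).support, ‖p i g x‖ ≤ C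

/-- Convergence along `l` in the ultraweak topology, that is in the weak-* topology of `L^∞(X)` as
the dual space of `L^1(X)`. -/
def UltraweakTendsto {I : Type*} (a : I → LInf μ) (l : Filter I) (b : LInf μ) : Prop :=
  ∀ φ : X → ℂ, Integrable φ μ →
    Tendsto (fun i => ∫ x, a i x * φ x ∂μ) l (𝓝 (∫ x, b x * φ x ∂μ))

/-- A net of finitely supported maps is bounded, its sums tend ultraweakly to `1`, and it is
approximately equivariant. -/
structure IsApproximatelyInvariant [QuasiInvariant Γ μ] {I : Type*} [Preorder I]
    (p : I → Γ →₀ LInf μ) : Prop where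
  bounded : IsBoundedFamily p
  total_tendsto : UltraweakTendsto (fun i => total (p i)) atTop (linfOne μ)
  pairing_tendsto : ∀ (f : LInf (prodMeasure Γ μ)) (h : Γ),
    UltraweakTendsto (fun i => pairing (actFin h (p i) - p i) f) atTop 0

end Action

end

end MeasuredAction

/-! The implications are closed in the cycle 1 → 2 → 5 → 4 → 3 → 1; only 4 → 3 is immediate.

1 → 2 averages `P` with its conjugate `f ↦ star (P (star f))` (`exists_isStarPreserving`).

2 → 5 is a Jordan decomposition. Integrating `P` gives a bounded functional `Φ`, real on
self-adjoint functions. A sequence `h n` in the order interval `[0, 1]` along which `Re Φ` tends to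
its supremum plays the role of the positive set in a Hahn decomposition, and an ultraweak limit of
`f ↦ P (h n * f)` is the least positive majorant `Q` of `P` (`exists_least_positive_majorant`).
Leastness determines `Q` on nonnegative functions, so `Q` inherits equivariance from `P`. Since `Q 1
≥ P 1 = 1`, the invariant function `Q 1` is invertible, and dividing by it makes `Q` unital
(`exists_isPositive`).

5 → 4 uses no convexity argument: the maps `pairing (p i)` converge to `P` itself. Finitely many
functions are nearly constant on the level sets of one simple function `s` on `Γ × X`. The weights
`q k = P (1_{s = k})` sum to one, and by module linearity `q k` vanishes at almost every `x` for
which `s (·, x)` never takes the value `k`. Elsewhere the mass `q k x` is placed at the first `g`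
with `s (g, x) = k`. Cutting down to finitely many `g` gives the finitely supported maps
(`exists_finsupp_approx`), and equivariance of `P` becomes approximate invariance of the net.

3 → 1 takes a limit along an ultrafilter, by weak-* compactness of balls
(`exists_ultraweakTendsto`). Translating `p` conjugates its pairing operator by the group action
(`pairing_actFin`), so condition (b) says that the limit is equivariant.

The final claim needs only contractivity, which follows by rotating `ξ` by a phase taken from
`L^∞(X)` (`isConditionalExpectation_of_isPositive`). -/

namespace MeasuredAction

noncomputable section

/-! ### The algebra, order and composition operators of `L^∞`. -/

section Functions

variable {α β : Type*} [MeasurableSpace α] [MeasurableSpace β] {ν : Measure α} {ρ : Measure β}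

theorem ae_norm_le_norm (f : LInf ν) : ∀ᵐ x ∂ν, ‖f x‖ ≤ ‖f‖ := by
  filter_upwards [ae_le_eLpNormEssSup (f := (f : α → ℂ)) (μ := ν)] with y hy
  rw [Lp.norm_def, eLpNorm_exponent_top, ← toReal_enorm]
  refine ENNReal.toReal_mono ?_ hy
  have := Lp.eLpNorm_ne_top f
  rwa [eLpNorm_exponent_top] at this

theorem norm_le_of_ae_le {f : LInf ν} {C : ℝ} (hC : 0 ≤ C) (h : ∀ᵐ x ∂ν, ‖f x‖ ≤ C) :
    ‖f‖ ≤ C := by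
  rw [Lp.norm_def, eLpNorm_exponent_top]
  exact ENNReal.toReal_le_of_le_ofReal hC (eLpNormEssSup_le_of_ae_bound h)

/-- The class of a bounded measurable function. -/
def linfMk (ν : Measure α) (f : α → ℂ) (hf : Measurable f) (C : ℝ) (hC : ∀ x, ‖f x‖ ≤ C) :
    LInf ν :=
  (memLp_top_of_bound hf.aestronglyMeasurable C (Eventually.of_forall hC)).toLp f

theorem coeFn_linfMk (f : α → ℂ) (hf : Measurable f) (C : ℝ) (hC : ∀ x, ‖f x‖ ≤ C) :
    (linfMk ν f hf C hC : α → ℂ) =ᵐ[ν] f :=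
  MemLp.coeFn_toLp _

/-- The class of the indicator function of a measurable set. -/
def linfInd (ν : Measure α) (s : Set α) (hs : MeasurableSet s) : LInf ν :=
  linfMk ν (s.indicator fun _ => 1) (measurable_const.indicator hs) 1 fun x => by
    by_cases h : x ∈ s <;> simp [h]

theorem coeFn_linfInd (s : Set α) (hs : MeasurableSet s) :
    (linfInd ν s hs : α → ℂ) =ᵐ[ν] s.indicator fun _ => 1 :=
  coeFn_linfMk _ _ _ _

theorem measurable_coeFn (f : LInf ν) : Measurable (f : α → ℂ) :=
  (Lp.stronglyMeasurable f).measurable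

theorem coeFn_star_apply (f : LInf ν) : ∀ᵐ x ∂ν, (star f : LInf ν) x = star (f x) :=
  Lp.coeFn_star f

theorem linfMul_add (a b c : LInf ν) : linfMul a (b + c) = linfMul a b + linfMul a c :=
  Lp.add_smul a b c

theorem linfMul_smul (z : ℂ) (a b : LInf ν) : linfMul a (z • b) = z • linfMul a b :=
  (Lp.smul_comm z a b).symm

theorem linfMul_comm (a b : LInf ν) : linfMul a b = linfMul b a := by
  apply Lp.ext
  filter_upwards [coeFn_linfMul a b, coeFn_linfMul b a] with x h1 h2
  rw [h1, h2, mul_comm]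

theorem linfMul_assoc (a b c : LInf ν) :
    linfMul (linfMul a b) c = linfMul a (linfMul b c) := by
  apply Lp.ext
  filter_upwards [coeFn_linfMul a b, coeFn_linfMul b c, coeFn_linfMul (linfMul a b) c,
    coeFn_linfMul a (linfMul b c)] with x h1 h2 h3 h4
  rw [h3, h4, h1, h2, mul_assoc]

theorem linfMul_one (a : LInf ν) : linfMul a (linfOne ν) = a := by
  apply Lp.ext
  filter_upwards [coeFn_linfMul a (linfOne ν), coeFn_linfOne ν] with x h1 h2
  rw [h1, h2, mul_one]

theorem one_linfMul (a : LInf ν) : linfMul (linfOne ν) a = a := by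
  rw [linfMul_comm, linfMul_one]

theorem norm_linfMul_le (a b : LInf ν) : ‖linfMul a b‖ ≤ ‖a‖ * ‖b‖ :=
  Lp.norm_smul_le a b

theorem star_linfMul (a b : LInf ν) : star (linfMul a b) = linfMul (star a) (star b) := by
  apply Lp.ext
  filter_upwards [coeFn_linfMul a b, coeFn_linfMul (star a) (star b), coeFn_star_apply a,
    coeFn_star_apply b, coeFn_star_apply (linfMul a b)] with x h1 h2 h3 h4 h5
  rw [h5, h1, h2, h3, h4, star_mul']

theorem star_linfOne : star (linfOne ν) = linfOne ν := by
  apply Lp.ext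
  filter_upwards [coeFn_linfOne ν, coeFn_star_apply (linfOne ν)] with x h1 h2
  rw [h2, h1, star_one]

theorem linf_star_add (a b : LInf ν) : star (a + b) = star a + star b := by
  apply Lp.ext
  filter_upwards [coeFn_star_apply a, coeFn_star_apply b, coeFn_star_apply (a + b),
    Lp.coeFn_add a b, Lp.coeFn_add (star a) (star b)] with x h1 h2 h3 h4 h5
  rw [h3, h5, h4, Pi.add_apply, Pi.add_apply, h1, h2, star_add]

theorem linf_star_smul (z : ℂ) (a : LInf ν) : star (z • a) = star z • star a := by
  apply Lp.ext
  filter_upwards [coeFn_star_apply a, coeFn_star_apply (z • a),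
    Lp.coeFn_smul z a, Lp.coeFn_smul (star z) (star a)] with x h1 h2 h3 h4
  rw [h2, h4, h3, Pi.smul_apply, Pi.smul_apply, h1, smul_eq_mul, star_mul', smul_eq_mul]

theorem linf_star_sub (a b : LInf ν) : star (a - b) = star a - star b := by
  apply Lp.ext
  filter_upwards [coeFn_star_apply a, coeFn_star_apply b, coeFn_star_apply (a - b),
    Lp.coeFn_sub a b, Lp.coeFn_sub (star a) (star b)] with x h1 h2 h3 h4 h5
  rw [h3, h5, h4, Pi.sub_apply, Pi.sub_apply, h1, h2, star_sub]

theorem norm_linf_star (a : LInf ν) : ‖star a‖ = ‖a‖ := by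
  have h (b : LInf ν) : ‖star b‖ ≤ ‖b‖ := by
    refine norm_le_of_ae_le (norm_nonneg b) ?_
    filter_upwards [coeFn_star_apply b, ae_norm_le_norm b] with x h1 h2
    rwa [h1, norm_star]
  refine le_antisymm (h a) ?_
  simpa only [star_star] using h (star a)

/-- Multiplication by an essentially bounded function as a linear map. -/
def linfMulLeft (a : LInf ν) : LInf ν →ₗ[ℂ] LInf ν where
  toFun := linfMul a
  map_add' := linfMul_add a
  map_smul' z b := linfMul_smul z a b

@[simp] theorem linfMulLeft_apply (a b : LInf ν) : linfMulLeft a b = linfMul a b := rfl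

theorem nonneg_iff {f : LInf ν} : 0 ≤ f ↔ ∀ᵐ x ∂ν, 0 ≤ f x :=
  (Lp.coeFn_nonneg f).symm

theorem le_iff {f g : LInf ν} : f ≤ g ↔ ∀ᵐ x ∂ν, f x ≤ g x :=
  (Lp.coeFn_le f g).symm

theorem linfOne_nonneg : 0 ≤ linfOne ν := by
  rw [nonneg_iff]
  filter_upwards [coeFn_linfOne ν] with x h
  rw [h]
  exact zero_le_one

theorem linfMul_nonneg {a b : LInf ν} (ha : 0 ≤ a) (hb : 0 ≤ b) : 0 ≤ linfMul a b := by
  rw [nonneg_iff] at *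
  filter_upwards [ha, hb, coeFn_linfMul a b] with x h1 h2 h3
  rw [h3]
  exact mul_nonneg h1 h2

theorem linfInd_nonneg (s : Set α) (hs : MeasurableSet s) : 0 ≤ linfInd ν s hs := by
  rw [nonneg_iff]
  filter_upwards [coeFn_linfInd s hs] with x h
  rw [h]
  exact Set.indicator_nonneg (fun _ _ => zero_le_one) x

theorem linfInd_le_one (s : Set α) (hs : MeasurableSet s) : linfInd ν s hs ≤ linfOne ν := by
  rw [le_iff]
  filter_upwards [coeFn_linfInd s hs, coeFn_linfOne ν] with x h h1
  rw [h, h1]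
  exact Set.indicator_le_self' (fun _ _ => zero_le_one) x

theorem star_eq_self_of_nonneg {f : LInf ν} (hf : 0 ≤ f) : star f = f := by
  apply Lp.ext
  filter_upwards [nonneg_iff.1 hf, coeFn_star_apply f] with x h1 h2
  rw [h2]
  exact Complex.conj_eq_iff_im.2 (Complex.le_def.1 h1).2.symm

theorem le_norm_smul_one {f : LInf ν} (hf : star f = f) :
    f ≤ ((‖f‖ : ℝ) : ℂ) • linfOne ν := by
  rw [le_iff]
  filter_upwards [ae_norm_le_norm f, coeFn_star_apply f, coeFn_linfOne ν,
    Lp.coeFn_smul ((‖f‖ : ℝ) : ℂ) (linfOne ν)] with x h1 h2 h3 h4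
  rw [hf] at h2
  have him : (f x).im = 0 := Complex.conj_eq_iff_im.1 h2.symm
  rw [h4, Pi.smul_apply, h3, smul_eq_mul, mul_one, Complex.le_def]
  exact ⟨(Complex.re_le_norm _).trans h1, by simpa using him⟩

theorem linfComp_add (φ : α → β) (hφ : Measure.QuasiMeasurePreserving φ ν ρ) (f g : LInf ρ) :
    linfComp φ hφ (f + g) = linfComp φ hφ f + linfComp φ hφ g := by
  apply Lp.ext
  filter_upwards [coeFn_linfComp φ hφ (f + g), coeFn_linfComp φ hφ f, coeFn_linfComp φ hφ g,
    Lp.coeFn_add (linfComp φ hφ f) (linfComp φ hφ g), hφ.ae (Lp.coeFn_add f g)]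
    with x h1 h2 h3 h4 h5
  rw [h1, h4, Pi.add_apply, h2, h3, h5, Pi.add_apply]

theorem linfComp_smul (φ : α → β) (hφ : Measure.QuasiMeasurePreserving φ ν ρ) (z : ℂ)
    (f : LInf ρ) : linfComp φ hφ (z • f) = z • linfComp φ hφ f := by
  apply Lp.ext
  filter_upwards [coeFn_linfComp φ hφ (z • f), coeFn_linfComp φ hφ f,
    Lp.coeFn_smul z (linfComp φ hφ f), hφ.ae (Lp.coeFn_smul z f)]
    with x h1 h2 h4 h5
  rw [h1, h4, Pi.smul_apply, h2, h5, Pi.smul_apply]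

/-- Composition with a nonsingular map as a linear map. -/
def linfCompₗ (φ : α → β) (hφ : Measure.QuasiMeasurePreserving φ ν ρ) : LInf ρ →ₗ[ℂ] LInf ν where
  toFun := linfComp φ hφ
  map_add' := linfComp_add φ hφ
  map_smul' z f := linfComp_smul φ hφ z f

theorem linfComp_mul (φ : α → β) (hφ : Measure.QuasiMeasurePreserving φ ν ρ) (f g : LInf ρ) :
    linfComp φ hφ (linfMul f g) = linfMul (linfComp φ hφ f) (linfComp φ hφ g) := by
  apply Lp.ext
  filter_upwards [coeFn_linfComp φ hφ (linfMul f g), coeFn_linfComp φ hφ f, coeFn_linfComp φ hφ g,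
    coeFn_linfMul (linfComp φ hφ f) (linfComp φ hφ g), hφ.ae (coeFn_linfMul f g)]
    with x h1 h2 h3 h4 h5
  rw [h1, h4, h2, h3, h5]

theorem linfComp_one (φ : α → β) (hφ : Measure.QuasiMeasurePreserving φ ν ρ) :
    linfComp φ hφ (linfOne ρ) = linfOne ν := by
  apply Lp.ext
  filter_upwards [coeFn_linfComp φ hφ (linfOne ρ), coeFn_linfOne ν, hφ.ae (coeFn_linfOne ρ)]
    with x h1 h2 h3
  rw [h1, h2, h3]

theorem linfComp_star (φ : α → β) (hφ : Measure.QuasiMeasurePreserving φ ν ρ) (f : LInf ρ) :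
    linfComp φ hφ (star f) = star (linfComp φ hφ f) := by
  apply Lp.ext
  filter_upwards [coeFn_linfComp φ hφ (star f), coeFn_linfComp φ hφ f,
    coeFn_star_apply (linfComp φ hφ f), hφ.ae (coeFn_star_apply f)] with x h1 h2 h3 h4
  rw [h1, h3, h2, h4]

theorem linfComp_nonneg (φ : α → β) (hφ : Measure.QuasiMeasurePreserving φ ν ρ) {f : LInf ρ}
    (hf : 0 ≤ f) : 0 ≤ linfComp φ hφ f := by
  rw [nonneg_iff] at *
  filter_upwards [coeFn_linfComp φ hφ f, hφ.ae hf] with x h1 h2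
  rwa [h1]

theorem norm_linfComp_le (φ : α → β) (hφ : Measure.QuasiMeasurePreserving φ ν ρ) (f : LInf ρ) :
    ‖linfComp φ hφ f‖ ≤ ‖f‖ := by
  refine norm_le_of_ae_le (norm_nonneg f) ?_
  filter_upwards [coeFn_linfComp φ hφ f, hφ.ae (ae_norm_le_norm f)] with x h1 h2
  rwa [h1]

theorem linfComp_comp {γ : Type*} [MeasurableSpace γ] {τ : Measure γ} (φ : α → β)
    (hφ : Measure.QuasiMeasurePreserving φ ν ρ) (ψ : β → γ)
    (hψ : Measure.QuasiMeasurePreserving ψ ρ τ) (f : LInf τ) :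
    linfComp φ hφ (linfComp ψ hψ f) = linfComp (ψ ∘ φ) (hψ.comp hφ) f := by
  apply Lp.ext
  filter_upwards [coeFn_linfComp φ hφ (linfComp ψ hψ f), coeFn_linfComp (ψ ∘ φ) (hψ.comp hφ) f,
    hφ.ae (coeFn_linfComp ψ hψ f)] with x h1 h2 h3
  rw [h1, h2, h3, Function.comp_apply]

theorem linfComp_eq_self (φ : α → α) (hφ : Measure.QuasiMeasurePreserving φ ν ν)
    (h : ∀ x, φ x = x) (f : LInf ν) : linfComp φ hφ f = f := by
  apply Lp.ext
  filter_upwards [coeFn_linfComp φ hφ f] with x h1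
  rw [h1, h x]

theorem coeFn_finset_sum {ι : Type*} (s : Finset ι) (f : ι → LInf ν) :
    ∀ᵐ x ∂ν, (∑ i ∈ s, f i : LInf ν) x = ∑ i ∈ s, f i x := by
  classical
  induction s using Finset.induction_on with
  | empty =>
    filter_upwards [Lp.coeFn_zero ℂ ∞ ν] with x h
    simpa using h
  | insert i s hi ih =>
    filter_upwards [ih, Lp.coeFn_add (f i) (∑ i ∈ s, f i)] with x h1 h2
    rw [Finset.sum_insert hi, Finset.sum_insert hi, h2, Pi.add_apply, h1]

end Functions

/-! ### Positive maps are monotone and star-preserving. -/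

section PositiveMaps

variable {α β : Type*} [MeasurableSpace α] [MeasurableSpace β] {ν : Measure α} {ρ : Measure β}
  {P : LInf ν →ₗ[ℂ] LInf ρ}

theorem map_le_map_of_positive (hP : ∀ f, 0 ≤ f → 0 ≤ P f) {f g : LInf ν} (h : f ≤ g) :
    P f ≤ P g := by
  have := hP (g - f) (sub_nonneg.2 h)
  rwa [map_sub, sub_nonneg] at this

/-- A self-adjoint `f` is the difference of the nonnegative functions `‖f‖ • 1` and `‖f‖ • 1 - f`,
whose images are nonnegative and hence self-adjoint. -/
theorem star_map_of_positive_of_selfAdjoint (hP : ∀ f, 0 ≤ f → 0 ≤ P f) {f : LInf ν}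
    (hf : star f = f) : star (P f) = P f := by
  set c : ℂ := ((‖f‖ : ℝ) : ℂ)
  have h1 : P f = P (c • linfOne ν) - P (c • linfOne ν - f) := by
    rw [map_sub, sub_sub_cancel]
  have h2 : star (P (c • linfOne ν - f)) = P (c • linfOne ν - f) :=
    star_eq_self_of_nonneg (hP _ (sub_nonneg.2 (le_norm_smul_one hf)))
  have h3 : 0 ≤ c • linfOne ν := by
    rw [nonneg_iff]
    filter_upwards [coeFn_linfOne ν, Lp.coeFn_smul c (linfOne ν)] with x h1 h2
    rw [h2, Pi.smul_apply, h1, smul_eq_mul, mul_one]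
    exact Complex.zero_le_real.2 (norm_nonneg f)
  rw [h1, linf_star_sub, h2, star_eq_self_of_nonneg (hP _ h3)]

/-- Both `f + star f` and `i (f - star f)` are self-adjoint, so the previous case applies to them;
the two resulting identities are combined to isolate `P (star f)`. -/
theorem star_map_of_positive (hP : ∀ f, 0 ≤ f → 0 ≤ P f) (f : LInf ν) :
    P (star f) = star (P f) := by
  have key {g : LInf ν} (hg : star g = g) : star (P g) = P g :=
    star_map_of_positive_of_selfAdjoint hP hg
  have h1 : star (P (f + star f)) = P (f + star f) :=
    key (by rw [linf_star_add, star_star, add_comm])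
  have h2 : star (P (Complex.I • (f - star f))) = P (Complex.I • (f - star f)) := by
    refine key ?_
    rw [linf_star_smul, linf_star_sub, star_star]
    simp only [Complex.star_def, Complex.conj_I, neg_smul, ← smul_neg, neg_sub]
  rw [map_add, linf_star_add] at h1
  rw [map_smul, linf_star_smul, map_sub, linf_star_sub] at h2
  simp only [Complex.star_def, Complex.conj_I, neg_smul, ← smul_neg, neg_sub] at h2
  have h3 := smul_right_injective _ Complex.I_ne_zero h2
  have h4 : (2 : ℂ) • P (star f) = (2 : ℂ) • star (P f) := by
    rw [two_smul, two_smul]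
    calc P (star f) + P (star f) = (P f + P (star f)) - (P f - P (star f)) := by abel
      _ = (star (P f) + star (P (star f))) - (star (P (star f)) - star (P f)) := by
        rw [h1, ← h3]
      _ = star (P f) + star (P f) := by abel
  exact smul_right_injective _ (two_ne_zero) h4

end PositiveMaps

/-! ### Ultraweak convergence and weak-* compactness. -/

section Ultraweak

variable {X : Type*} [MeasurableSpace X] {μ : Measure X}

theorem integrable_coeFn_mul (a : LInf μ) {φ : X → ℂ} (hφ : Integrable φ μ) :
    Integrable (fun x => a x * φ x) μ :=
  hφ.bdd_mul (Lp.aestronglyMeasurable a) (ae_norm_le_norm a)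

theorem norm_integral_coeFn_mul_le (a : LInf μ) {φ : X → ℂ} (hφ : Integrable φ μ) :
    ‖∫ x, a x * φ x ∂μ‖ ≤ ‖a‖ * ∫ x, ‖φ x‖ ∂μ := by
  rw [← integral_const_mul]
  refine norm_integral_le_of_norm_le (hφ.norm.const_mul _) ?_
  filter_upwards [ae_norm_le_norm a] with x hx
  rw [norm_mul]
  gcongr

variable {I : Type*} {l : Filter I} {a a' : I → LInf μ} {b b' : LInf μ}

theorem UltraweakTendsto.mono {l' : Filter I} (h : UltraweakTendsto a l b) (hl : l' ≤ l) :
    UltraweakTendsto a l' b :=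
  fun φ hφ => (h φ hφ).mono_left hl

theorem UltraweakTendsto.add (h : UltraweakTendsto a l b) (h' : UltraweakTendsto a' l b') :
    UltraweakTendsto (fun i => a i + a' i) l (b + b') := by
  intro φ hφ
  have key (c d : LInf μ) :
      ∫ x, (c + d : LInf μ) x * φ x ∂μ = ∫ x, c x * φ x ∂μ + ∫ x, d x * φ x ∂μ := by
    rw [← integral_add (integrable_coeFn_mul c hφ) (integrable_coeFn_mul d hφ)]
    refine integral_congr_ae ?_
    filter_upwards [Lp.coeFn_add c d] with x hx
    rw [hx, Pi.add_apply, add_mul]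
  simp only [key]
  exact (h φ hφ).add (h' φ hφ)

theorem UltraweakTendsto.const_smul (z : ℂ) (h : UltraweakTendsto a l b) :
    UltraweakTendsto (fun i => z • a i) l (z • b) := by
  intro φ hφ
  have key (c : LInf μ) : ∫ x, (z • c : LInf μ) x * φ x ∂μ = z * ∫ x, c x * φ x ∂μ := by
    rw [← integral_const_mul]
    refine integral_congr_ae ?_
    filter_upwards [Lp.coeFn_smul z c] with x hx
    rw [hx, Pi.smul_apply, smul_eq_mul, mul_assoc]
  simp only [key]
  exact (h φ hφ).const_mul z

theorem UltraweakTendsto.sub (h : UltraweakTendsto a l b) (h' : UltraweakTendsto a' l b') :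
    UltraweakTendsto (fun i => a i - a' i) l (b - b') := by
  simpa only [neg_one_smul, ← sub_eq_add_neg] using h.add (h'.const_smul (-1))

theorem UltraweakTendsto.linfMul (c : LInf μ) (h : UltraweakTendsto a l b) :
    UltraweakTendsto (fun i => linfMul c (a i)) l (linfMul c b) := by
  intro φ hφ
  have key (d : LInf μ) :
      ∫ x, (MeasuredAction.linfMul c d : LInf μ) x * φ x ∂μ = ∫ x, d x * (c x * φ x) ∂μ := by
    refine integral_congr_ae ?_
    filter_upwards [coeFn_linfMul c d] with x hx
    rw [hx]
    ring
  simp only [key]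
  exact h _ (integrable_coeFn_mul c hφ)

/-- Composition with `T` is the adjoint of an operator on `L^1`: since `φ = φ ∘ S ∘ T`, the change
of variables along `T` turns the test function `φ` into `ψ`, which is `φ ∘ S` times the
Radon–Nikodym density of the pushforward of `μ` under `T`. -/
theorem UltraweakTendsto.linfComp [IsFiniteMeasure μ] (T : X → X)
    (hT : Measure.QuasiMeasurePreserving T μ μ) (S : X → X) (hS : Measurable S)
    (hST : ∀ x, S (T x) = x) (h : UltraweakTendsto a l b) :
    UltraweakTendsto (fun i => linfComp T hT (a i)) l (linfComp T hT b) := by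
  intro φ hφ
  set ψ : X → ℂ := fun y => ((μ.map T).rnDeriv μ y).toReal • φ (S y)
  have hφS' : Integrable (fun x => φ (S (T x))) μ := by simpa only [hST] using hφ
  have hSae : AEStronglyMeasurable (fun y => φ (S y)) (μ.map T) := by
    refine hφ.aestronglyMeasurable.comp_measurePreserving ⟨hS, ?_⟩
    rw [Measure.map_map hS hT.measurable]
    simp [Function.comp_def, hST]
  have hφS : Integrable (fun y => φ (S y)) (μ.map T) :=
    (integrable_map_measure hSae hT.measurable.aemeasurable).2 hφS'
  have hψ : Integrable ψ μ := (integrable_rnDeriv_smul_iff hT.absolutelyContinuous).2 hφS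
  have key (d : LInf μ) :
      ∫ x, (MeasuredAction.linfComp T hT d : LInf μ) x * φ x ∂μ = ∫ x, d x * ψ x ∂μ := by
    have h1 : ∫ x, d x * ψ x ∂μ
        = ∫ x, ((μ.map T).rnDeriv μ x).toReal • (d x * φ (S x)) ∂μ := by
      refine integral_congr_ae (Eventually.of_forall fun x => ?_)
      simp only [ψ, mul_smul_comm]
    have h2 : ∫ y, d y * φ (S y) ∂(μ.map T) = ∫ x, d (T x) * φ (S (T x)) ∂μ :=
      integral_map hT.measurable.aemeasurable
        ((measurable_coeFn d).aestronglyMeasurable.mul hSae)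
    rw [h1, integral_rnDeriv_smul hT.absolutelyContinuous, h2]
    refine integral_congr_ae ?_
    filter_upwards [coeFn_linfComp T hT d] with x hx
    rw [hx, hST]
  simp only [key]
  exact h ψ hψ

theorem eq_of_forall_integral_mul_eq [IsFiniteMeasure μ] {c d : LInf μ}
    (h : ∀ s, MeasurableSet s → ∫ x in s, c x ∂μ = ∫ x in s, d x ∂μ) : c = d := by
  have hc (c : LInf μ) : Integrable c μ := by
    simpa using integrable_coeFn_mul c (integrable_const (1 : ℂ))
  apply Lp.ext
  exact (hc c).ae_eq_of_forall_setIntegral_eq _ _ (hc d) fun s hs _ => h s hs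

theorem integral_mul_indicator (c : LInf μ) {s : Set X} (hs : MeasurableSet s) :
    ∫ x, c x * s.indicator (fun _ => (1 : ℂ)) x ∂μ = ∫ x in s, c x ∂μ := by
  rw [← integral_indicator hs]
  refine integral_congr_ae (Eventually.of_forall fun x => ?_)
  by_cases hx : x ∈ s <;> simp [hx]

theorem UltraweakTendsto.setIntegral [IsFiniteMeasure μ] (h : UltraweakTendsto a l b)
    {s : Set X} (hs : MeasurableSet s) :
    Tendsto (fun i => ∫ x in s, a i x ∂μ) l (𝓝 (∫ x in s, b x ∂μ)) := by
  simpa only [integral_mul_indicator _ hs] using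
    h (s.indicator fun _ => 1) ((integrable_const (1 : ℂ)).indicator hs)

theorem UltraweakTendsto.unique [IsFiniteMeasure μ] [l.NeBot] (h : UltraweakTendsto a l b)
    (h' : UltraweakTendsto a l b') : b = b' :=
  eq_of_forall_integral_mul_eq fun _ hs =>
    tendsto_nhds_unique (h.setIntegral hs) (h'.setIntegral hs)

theorem nonneg_of_setIntegral_nonneg [IsFiniteMeasure μ] {c : LInf μ}
    (h : ∀ s, MeasurableSet s → 0 ≤ ∫ x in s, c x ∂μ) : 0 ≤ c := by
  have hc : Integrable c μ := by
    simpa using integrable_coeFn_mul c (integrable_const (1 : ℂ))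
  have hre : 0 ≤ᵐ[μ] fun x => (c x).re := by
    refine ae_nonneg_of_forall_setIntegral_nonneg hc.re fun s hs _ => ?_
    have := (Complex.le_def.1 (h s hs)).1
    rwa [← RCLike.re_eq_complex_re, ← integral_re hc.integrableOn] at this
  have him : (fun x => (c x).im) =ᵐ[μ] 0 := by
    refine hc.im.ae_eq_zero_of_forall_setIntegral_eq_zero fun s hs _ => ?_
    have := (Complex.le_def.1 (h s hs)).2
    rw [← RCLike.im_eq_complex_im, ← integral_im hc.integrableOn] at this
    simpa using this.symm
  rw [nonneg_iff]
  filter_upwards [hre, him] with x h1 h2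
  exact Complex.le_def.2 ⟨h1, h2.symm⟩

/-- For a bounded family, ultraweak convergence may be tested on simple functions. -/
theorem ultraweakTendsto_of_bounded [IsFiniteMeasure μ] {C : ℝ} (hC : ∀ i, ‖a i‖ ≤ C)
    (h : ∀ ψ : SimpleFunc X ℂ,
      Tendsto (fun i => ∫ x, a i x * ψ x ∂μ) l (𝓝 (∫ x, b x * ψ x ∂μ))) :
    UltraweakTendsto a l b := by
  intro φ hφ
  rw [Metric.tendsto_nhds]
  intro ε hε
  -- The summand `1` makes `D` positive and the final estimate strict.
  set D : ℝ := |C| + ‖b‖ + 1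
  have hD : 0 < D := by positivity
  obtain ⟨ψ, hψ, hψ1⟩ := (memLp_one_iff_integrable.2 hφ).exists_simpleFunc_eLpNorm_sub_lt
    (by simp) (ε := ENNReal.ofReal (ε / (2 * D))) (by simpa using by positivity)
  rw [memLp_one_iff_integrable] at hψ1
  have hint : Integrable (fun x => φ x - ψ x) μ := hφ.sub hψ1
  have hsmall : ∫ x, ‖φ x - ψ x‖ ∂μ < ε / (2 * D) := by
    rw [eLpNorm_one_eq_lintegral_enorm] at hψ
    rw [integral_norm_eq_lintegral_enorm hint.aestronglyMeasurable]
    exact ENNReal.toReal_lt_of_lt_ofReal hψ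
  have hdiff (c : LInf μ) :
      ‖∫ x, c x * φ x ∂μ - ∫ x, c x * ψ x ∂μ‖ ≤ ‖c‖ * (ε / (2 * D)) := by
    rw [← integral_sub (integrable_coeFn_mul c hφ) (integrable_coeFn_mul c hψ1)]
    simp only [← mul_sub]
    exact (norm_integral_coeFn_mul_le c hint).trans (by gcongr)
  filter_upwards [Metric.tendsto_nhds.1 (h ψ) (ε / 2) (by positivity)] with i hi
  have h1 : ‖a i‖ * (ε / (2 * D)) ≤ |C| * (ε / (2 * D)) := by
    gcongr
    exact (hC i).trans (le_abs_self C)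
  have h2 : (|C| + ‖b‖) * (ε / (2 * D)) < D * (ε / (2 * D)) := by
    gcongr
    simp [D]
  have h3 : D * (ε / (2 * D)) = ε / 2 := by field_simp
  rw [dist_eq_norm] at hi ⊢
  have h4 : ∫ x, a i x * φ x ∂μ - ∫ x, b x * φ x ∂μ
      = (∫ x, a i x * φ x ∂μ - ∫ x, a i x * ψ x ∂μ)
        + (∫ x, a i x * ψ x ∂μ - ∫ x, b x * ψ x ∂μ)
        - (∫ x, b x * φ x ∂μ - ∫ x, b x * ψ x ∂μ) := by ring
  rw [h4]
  refine ((norm_sub_le _ _).trans (add_le_add (norm_add_le _ _) le_rfl)).trans_lt ?_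
  have := hdiff (a i)
  have := hdiff b
  linarith

/-- Bounded families of essentially bounded functions converge ultraweakly along ultrafilters. -/
theorem exists_ultraweakTendsto [IsProbabilityMeasure μ] (U : Ultrafilter I) {C : ℝ}
    (hC : ∀ i, ‖a i‖ ≤ C) : ∃ b : LInf μ, ‖b‖ ≤ C ∧ UltraweakTendsto a U b := by
  obtain ⟨i₀⟩ : Nonempty I := U.nonempty_of_mem Filter.univ_mem |>.to_type
  have hC0 : 0 ≤ C := (norm_nonneg _).trans (hC i₀)
  have hLp (φ : Lp ℂ 2 μ) : Integrable φ μ := (Lp.memLp φ).integrable (by norm_num)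
  have hbound {φ : X → ℂ} (hφ : Integrable φ μ) (i : I) :
      ‖∫ x, a i x * φ x ∂μ‖ ≤ C * ∫ x, ‖φ x‖ ∂μ :=
    (norm_integral_coeFn_mul_le (a i) hφ).trans (by gcongr; exact hC i)
  -- The limit functional is built on `L^2`, which lies in `L^1` because `μ` is finite, so that the
  -- Riesz theorem for Hilbert spaces represents it.
  have hlim (φ : Lp ℂ 2 μ) : ∃ z : ℂ, Tendsto (fun i => ∫ x, a i x * φ x ∂μ) U (𝓝 z) := by
    obtain ⟨z, -, hz⟩ := (isCompact_closedBall (0 : ℂ) (C * ∫ x, ‖φ x‖ ∂μ)).ultrafilter_le_nhds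
      (U.map fun i => ∫ x, a i x * φ x ∂μ) (by
        rw [Filter.le_principal_iff]
        exact Filter.mem_map.2 (Eventually.of_forall fun i => by
          simpa using hbound (hLp φ) i))
    exact ⟨z, hz⟩
  choose L hL using hlim
  have hLnorm (φ : Lp ℂ 2 μ) : ‖L φ‖ ≤ C * ∫ x, ‖φ x‖ ∂μ :=
    le_of_tendsto (hL φ).norm (Eventually.of_forall (hbound (hLp φ)))
  have hL2 (φ : Lp ℂ 2 μ) : ∫ x, ‖φ x‖ ∂μ ≤ ‖φ‖ := by
    rw [integral_norm_eq_lintegral_enorm (Lp.aestronglyMeasurable φ), Lp.norm_def,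
      ← eLpNorm_one_eq_lintegral_enorm]
    exact ENNReal.toReal_mono (Lp.eLpNorm_ne_top φ)
      (eLpNorm_le_eLpNorm_of_exponent_le (by norm_num) (Lp.aestronglyMeasurable φ))
  let Λ : StrongDual ℂ (Lp ℂ 2 μ) := LinearMap.mkContinuous
    { toFun := L
      map_add' := fun φ ψ => by
        refine tendsto_nhds_unique (hL (φ + ψ)) (((hL φ).add (hL ψ)).congr fun i => ?_)
        rw [← integral_add (integrable_coeFn_mul _ (hLp φ)) (integrable_coeFn_mul _ (hLp ψ))]
        refine integral_congr_ae ?_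
        filter_upwards [Lp.coeFn_add φ ψ] with x hx
        rw [hx, Pi.add_apply, mul_add]
      map_smul' := fun z φ => by
        refine tendsto_nhds_unique (hL (z • φ)) (((hL φ).const_mul z).congr fun i => ?_)
        rw [← integral_const_mul]
        refine integral_congr_ae ?_
        filter_upwards [Lp.coeFn_smul z φ] with x hx
        rw [hx, Pi.smul_apply, smul_eq_mul]
        ring } C fun φ => (hLnorm φ).trans (by gcongr; exact hL2 φ)
  -- The inner product is conjugate-linear in its first variable, so the ultraweak limit is `star
  -- v`, not `v`.
  set v : Lp ℂ 2 μ := (InnerProductSpace.toDual ℂ (Lp ℂ 2 μ)).symm Λ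
  have hv (φ : Lp ℂ 2 μ) : ∫ x, star (v x) * φ x ∂μ = L φ := by
    have h1 : inner ℂ v φ = L φ := InnerProductSpace.toDual_symm_apply
    rw [← h1, L2.inner_def]
    refine integral_congr_ae (Eventually.of_forall fun x => ?_)
    simp [RCLike.inner_apply, mul_comm]
  have hvm : Measurable (v : X → ℂ) := (Lp.stronglyMeasurable v).measurable
  have hvC : (fun x => ‖v x‖) ≤ᵐ[μ] fun _ => C := by
    refine ae_le_of_forall_setIntegral_le (hLp v).norm (integrable_const C) fun s hs _ => ?_
    -- Testing against the phase of `v` on `s` turns the `L^1` bound for `L` into the bound of `∫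
    -- ‖v‖` over `s` by `C * μ s`. At zeros of `v` the convention `0 / 0 = 0` is harmless.
    set θ : X → ℂ := s.indicator fun x => v x / ‖v x‖
    have hθ (x : X) : ‖θ x‖ ≤ s.indicator (fun _ => (1 : ℝ)) x := by
      by_cases hx : x ∈ s
      · simp only [θ, Set.indicator_of_mem hx, norm_div, Complex.norm_real, norm_norm]
        exact div_self_le_one _
      · simp [θ, hx]
    have hθm : Measurable θ := (hvm.div (Complex.measurable_ofReal.comp hvm.norm)).indicator hs
    have hθL : MemLp θ 2 μ := MemLp.of_bound hθm.aestronglyMeasurable 1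
      (Eventually.of_forall fun x => (hθ x).trans (Set.indicator_le_self' (by simp) x))
    have h1 := hLnorm (hθL.toLp θ)
    rw [← hv] at h1
    have h2 : ∫ x, star (v x) * (hθL.toLp θ) x ∂μ = ((∫ x in s, ‖v x‖ ∂μ : ℝ) : ℂ) := by
      rw [← integral_indicator hs, ← integral_complex_ofReal]
      refine integral_congr_ae ?_
      filter_upwards [hθL.coeFn_toLp] with x hx
      rw [hx]
      by_cases hxs : x ∈ s
      · simp only [θ, Set.indicator_of_mem hxs]
        by_cases h0 : v x = 0
        · simp [h0]
        · have h0' : ((‖v x‖ : ℝ) : ℂ) ≠ 0 := by simpa using h0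
          rw [mul_div_assoc', div_eq_iff h0', Complex.star_def, Complex.conj_mul']
          ring
      · simp [θ, hxs]
    have h3 : ∫ x, ‖(hθL.toLp θ) x‖ ∂μ ≤ ∫ x, s.indicator (fun _ => (1 : ℝ)) x ∂μ := by
      refine integral_mono_ae (hLp _).norm ((integrable_const 1).indicator hs) ?_
      filter_upwards [hθL.coeFn_toLp] with x hx
      rw [hx]
      exact hθ x
    rw [h2, Complex.norm_real, Real.norm_eq_abs] at h1
    calc ∫ x in s, ‖v x‖ ∂μ ≤ _ := le_abs_self _
      _ ≤ _ := h1
      _ ≤ C * ∫ x, s.indicator (fun _ => (1 : ℝ)) x ∂μ := by gcongr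
      _ = ∫ x in s, C ∂μ := by
        rw [integral_indicator hs, ← integral_const_mul]
        simp
  have hbm : MemLp (fun x => star (v x)) ∞ μ := by
    refine memLp_top_of_bound (continuous_star.measurable.comp hvm).aestronglyMeasurable C ?_
    filter_upwards [hvC] with x hx
    rwa [norm_star]
  refine ⟨hbm.toLp _, norm_le_of_ae_le hC0 ?_, ultraweakTendsto_of_bounded hC fun ψ => ?_⟩
  · filter_upwards [hvC, hbm.coeFn_toLp] with x hx hx'
    rwa [hx', norm_star]
  · have hψ : MemLp ψ 2 μ := SimpleFunc.memLp_of_isFiniteMeasure ψ 2 μ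
    have h1 (f : X → ℂ) : ∫ x, f x * (hψ.toLp ψ) x ∂μ = ∫ x, f x * ψ x ∂μ := by
      refine integral_congr_ae ?_
      filter_upwards [hψ.coeFn_toLp] with x hx
      rw [hx]
    have h2 : ∫ x, (hbm.toLp _ : LInf μ) x * ψ x ∂μ = L (hψ.toLp ψ) := by
      rw [← hv, h1]
      refine integral_congr_ae ?_
      filter_upwards [hbm.coeFn_toLp] with x hx
      rw [hx]
    rw [h2]
    simpa only [h1] using hL (hψ.toLp ψ)

/-- Pointwise bounded families of linear maps converge along ultrafilters. -/
theorem exists_linearMap_ultraweakTendsto [IsProbabilityMeasure μ] {V : Type*}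
    [NormedAddCommGroup V] [NormedSpace ℂ V] (U : Ultrafilter I) (T : I → V →ₗ[ℂ] LInf μ) (C : ℝ)
    (hC : ∀ i v, ‖T i v‖ ≤ C * ‖v‖) :
    ∃ P : V →L[ℂ] LInf μ, ∀ v, UltraweakTendsto (fun i => T i v) U (P v) := by
  choose P hP1 hP using fun v : V => exists_ultraweakTendsto (a := fun i => T i v) U
    fun i => hC i v
  refine ⟨LinearMap.mkContinuous
    { toFun := P
      -- One ultrafilter serves all vectors, so linearity passes to the limit by uniqueness of
      -- limits.
      map_add' := fun v w => (hP (v + w)).unique (by simpa only [map_add] using (hP v).add (hP w))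
      map_smul' := fun z v => (hP (z • v)).unique
        (by
        simpa only [map_smul, RingHom.id_apply] using (hP v).const_smul z) } C hP1, hP⟩

end Ultraweak

/-! ### Pairing with finitely supported maps, the group action, and limits of approximately
invariant nets. -/

section Equivariance

variable {Γ : Type u} {X : Type v} [Group Γ] [Countable Γ] [MeasurableSpace Γ]
  [DiscreteMeasurableSpace Γ] [MeasurableSpace X] [MulAction Γ X] [MeasurableConstSMul Γ X]
  {μ : Measure X} [IsProbabilityMeasure μ]

theorem emb_nonneg {a : LInf μ} (ha : 0 ≤ a) : 0 ≤ emb Γ μ a :=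
  linfComp_nonneg _ _ ha

theorem sec_emb (g : Γ) (a : LInf μ) : sec μ g (emb Γ μ a) = a :=
  (linfComp_comp _ (qmp_section μ g) _ Measure.quasiMeasurePreserving_snd a).trans
    (linfComp_eq_self _ _ (fun _ => rfl) a)

theorem sec_one (g : Γ) : sec μ g (linfOne (prodMeasure Γ μ)) = linfOne μ :=
  linfComp_one _ _

theorem sec_mul (g : Γ) (f f' : LInf (prodMeasure Γ μ)) :
    sec μ g (linfMul f f') = linfMul (sec μ g f) (sec μ g f') :=
  linfComp_mul _ _ f f'

theorem total_eq_pairing_one (p : Γ →₀ LInf μ) :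
    total p = pairing p (linfOne (prodMeasure Γ μ)) := by
  simp only [total, pairing, sec_one, linfMul_one]

/-- The pairing with a finitely supported map as a linear map. -/
def pairingₗ (p : Γ →₀ LInf μ) : LInf (prodMeasure Γ μ) →ₗ[ℂ] LInf μ :=
  ∑ g ∈ p.support, linfMulLeft (p g) ∘ₗ linfCompₗ (fun x => (g, x)) (qmp_section μ g)

theorem pairingₗ_apply (p : Γ →₀ LInf μ) (f : LInf (prodMeasure Γ μ)) :
    pairingₗ p f = pairing p f := by
  simp only [pairingₗ, LinearMap.sum_apply, LinearMap.comp_apply, linfMulLeft_apply]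
  rfl

theorem pairing_sub_left (p q : Γ →₀ LInf μ) (f : LInf (prodMeasure Γ μ)) :
    pairing (p - q) f = pairing p f - pairing q f := by
  refine Finsupp.sum_sub_index fun g a b => ?_
  have := (linfMulLeft (sec μ g f)).map_sub a b
  simpa only [linfMulLeft_apply, linfMul_comm (sec μ g f)] using this

theorem pairing_emb_mul (p : Γ →₀ LInf μ) (a : LInf μ) (f : LInf (prodMeasure Γ μ)) :
    pairing p (linfMul (emb Γ μ a) f) = linfMul a (pairing p f) := by
  have h := map_sum (linfMulLeft a) (fun g => linfMul (p g) (sec μ g f)) p.support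
  simp only [linfMulLeft_apply] at h
  rw [pairing, pairing, Finsupp.sum, Finsupp.sum, h]
  refine Finset.sum_congr rfl fun g _ => ?_
  rw [sec_mul, sec_emb, ← linfMul_assoc, ← linfMul_assoc, linfMul_comm a]

theorem coeFn_pairing (p : Γ →₀ LInf μ) (f : LInf (prodMeasure Γ μ)) :
    ∀ᵐ x ∂μ, pairing p f x = ∑ g ∈ p.support, p g x * f (g, x) := by
  have h1 : ∀ᵐ x ∂μ, ∀ g : Γ, linfMul (p g) (sec μ g f) x = p g x * sec μ g f x :=
    ae_all_iff.2 fun g => coeFn_linfMul _ _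
  have h2 : ∀ᵐ x ∂μ, ∀ g : Γ, sec μ g f x = f (g, x) :=
    ae_all_iff.2 fun g => coeFn_linfComp _ _ _
  filter_upwards [h1, h2, coeFn_finset_sum p.support fun g => linfMul (p g) (sec μ g f)]
    with x h1 h2 h3
  rw [pairing, Finsupp.sum, h3]
  exact Finset.sum_congr rfl fun g _ => by rw [h1, h2]

/-- Countability of `Γ` allows a single null set in `X` to serve for all sections at once. -/
theorem ae_forall_section {f : LInf (prodMeasure Γ μ)} {p : Γ × X → ℂ → Prop}
    (h : ∀ᵐ y ∂(prodMeasure Γ μ), p y (f y)) : ∀ᵐ x ∂μ, ∀ g : Γ, p (g, x) (f (g, x)) :=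
  ae_all_iff.2 fun g => (qmp_section μ g).ae h

theorem norm_pairing_le {p : Γ →₀ LInf μ} {C : ℝ} (hC0 : 0 ≤ C)
    (hC : ∀ᵐ x ∂μ, ∑ g ∈ p.support, ‖p g x‖ ≤ C) (f : LInf (prodMeasure Γ μ)) :
    ‖pairing p f‖ ≤ C * ‖f‖ := by
  refine norm_le_of_ae_le (by positivity) ?_
  filter_upwards [hC, coeFn_pairing p f,
    ae_forall_section (p := fun _ z => ‖z‖ ≤ ‖f‖) (ae_norm_le_norm f)] with x h1 h2 h3
  rw [h2]
  calc ‖∑ g ∈ p.support, p g x * f (g, x)‖ ≤ ∑ g ∈ p.support, ‖p g x‖ * ‖f‖ := by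
        refine norm_sum_le_of_le _ fun g _ => ?_
        rw [norm_mul]
        gcongr
        exact h3 g
    _ ≤ C * ‖f‖ := by
        rw [← Finset.sum_mul]
        gcongr

variable [QuasiInvariant Γ μ]

theorem act_act_inv (g : Γ) (a : LInf μ) : act μ g (act μ g⁻¹ a) = a :=
  (linfComp_comp _ (qmp_smul μ g⁻¹) _ (qmp_smul μ g⁻¹⁻¹) a).trans
    (linfComp_eq_self _ _ (fun x => by simp) a)

theorem actProd_actProd_inv (g : Γ) (f : LInf (prodMeasure Γ μ)) :
    actProd μ g (actProd μ g⁻¹ f) = f :=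
  (linfComp_comp _ (qmp_prod_smul μ g⁻¹) _ (qmp_prod_smul μ g⁻¹⁻¹) f).trans
    (linfComp_eq_self _ _ (fun x => by simp) f)

theorem act_sec_actProd_inv (h g : Γ) (f : LInf (prodMeasure Γ μ)) :
    act μ h (sec μ g (actProd μ h⁻¹ f)) = sec μ (h * g) f := by
  have h1 := linfComp_comp _ (qmp_section μ g) _ (qmp_prod_smul μ h⁻¹⁻¹) f
  have h2 := linfComp_comp _ (qmp_smul μ h⁻¹) _
    ((qmp_prod_smul μ h⁻¹⁻¹).comp (qmp_section μ g)) f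
  refine (congrArg _ h1).trans (h2.trans ?_)
  simp only [sec, Function.comp_def, inv_inv, smul_inv_smul]

theorem act_mul (g : Γ) (a b : LInf μ) :
    act μ g (linfMul a b) = linfMul (act μ g a) (act μ g b) :=
  linfComp_mul _ _ a b

theorem act_one (g : Γ) : act μ g (linfOne μ) = linfOne μ :=
  linfComp_one _ _

theorem actProd_one (g : Γ) :
    actProd μ g (linfOne (prodMeasure Γ μ)) = linfOne (prodMeasure Γ μ) :=
  linfComp_one _ _

theorem act_nonneg (g : Γ) {a : LInf μ} (ha : 0 ≤ a) : 0 ≤ act μ g a :=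
  linfComp_nonneg _ _ ha

theorem actProd_nonneg (g : Γ) {f : LInf (prodMeasure Γ μ)} (hf : 0 ≤ f) : 0 ≤ actProd μ g f :=
  linfComp_nonneg _ _ hf

/-- The action of a group element on functions on `X` as a linear map. -/
def actₗ (g : Γ) : LInf μ →ₗ[ℂ] LInf μ := linfCompₗ (fun x => g⁻¹ • x) (qmp_smul μ g⁻¹)

theorem actₗ_apply (g : Γ) (a : LInf μ) : actₗ g a = act μ g a := rfl

/-- The action of a group element on functions on `Γ × X` as a linear map. -/
def actProdₗ (g : Γ) : LInf (prodMeasure Γ μ) →ₗ[ℂ] LInf (prodMeasure Γ μ) :=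
  linfCompₗ (fun p => (g⁻¹ * p.1, g⁻¹ • p.2)) (qmp_prod_smul μ g⁻¹)

theorem UltraweakTendsto.act {I : Type*} {l : Filter I} {a : I → LInf μ} {b : LInf μ} (g : Γ)
    (h : UltraweakTendsto a l b) : UltraweakTendsto (fun i => act μ g (a i)) l (act μ g b) :=
  h.linfComp _ _ (fun x => g • x) (measurable_const_smul g) fun x => by simp

/-- This turns approximate invariance of `p` into approximate equivariance of the operator `pairing
p`. It is the substitution `g ↦ h * g` in the defining sum. -/
theorem pairing_actFin (h : Γ) (p : Γ →₀ LInf μ) (f : LInf (prodMeasure Γ μ)) :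
    pairing (actFin h p) f = act μ h (pairing p (actProd μ h⁻¹ f)) := by
  have hs := map_sum (actₗ h) (fun g => linfMul (p g) (sec μ g (actProd μ h⁻¹ f))) p.support
  simp only [actₗ_apply, act_mul, act_sec_actProd_inv] at hs
  have h0 (g : Γ) : linfMul (0 : LInf μ) (sec μ g f) = 0 := by
    rw [linfMul_comm]
    exact (linfMulLeft (sec μ g f)).map_zero
  rw [pairing, actFin, Finsupp.sum_mapRange_index h0, Finsupp.sum_equivMapDomain, pairing,
    Finsupp.sum, Finsupp.sum, hs]
  rfl

/-- A limit point of an approximately invariant net is an equivariant module map. -/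
theorem exists_equivariant_of_isApproximatelyInvariant {I : Type*} [Preorder I]
    [IsDirectedOrder I] [Nonempty I] {p : I → Γ →₀ LInf μ} (hp : IsApproximatelyInvariant p) :
    ∃ P : LInf (prodMeasure Γ μ) →L[ℂ] LInf μ, IsUnital P ∧ IsModuleMap P ∧ IsEquivariant P := by
  obtain ⟨C, hC⟩ := hp.bounded
  have hC' (i : I) : ∀ᵐ x ∂μ, ∑ g ∈ (p i).support, ‖p i g x‖ ≤ |C| := by
    filter_upwards [hC i] with x hx using hx.trans (le_abs_self C)
  set U : Ultrafilter I := Ultrafilter.of atTop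
  have hU : (U : Filter I) ≤ atTop := Ultrafilter.of_le _
  obtain ⟨P, hP⟩ := exists_linearMap_ultraweakTendsto U (fun i => pairingₗ (p i)) |C|
    fun i f => by
      rw [pairingₗ_apply]
      exact norm_pairing_le (abs_nonneg C) (hC' i) f
  simp only [pairingₗ_apply] at hP
  refine ⟨P, ?_, fun a f => ?_, fun g f => ?_⟩
  · refine (hP _).unique ?_
    simpa only [total_eq_pairing_one] using hp.total_tendsto.mono hU
  · refine (hP _).unique ?_
    simpa only [pairing_emb_mul] using (hP f).linfMul a
  -- Evaluating at `g.f` makes the translated term equal to `g.(pairing (p i) f)`, whose limit is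
  -- `g.(P f)`.
  · have h1 := (hp.pairing_tendsto (actProd μ g f) g).mono hU
    have h2 : UltraweakTendsto (fun i => pairing (actFin g (p i) - p i) (actProd μ g f)) U
        (act μ g (P f) - P (actProd μ g f)) := by
      have h3 : actProd μ g⁻¹ (actProd μ g f) = f := by
        simpa only [inv_inv] using actProd_actProd_inv g⁻¹ f
      simpa only [pairing_sub_left, pairing_actFin, h3] using
        ((hP f).act g).sub (hP (actProd μ g f))
    exact (sub_eq_zero.1 (h2.unique h1)).symm

end Equivariance

/-! ### Order estimates and positivity of ultraweak limits. -/

section PositivePart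

variable {α β : Type*} [MeasurableSpace α] [MeasurableSpace β] {ν : Measure α} {ρ : Measure β}

theorem smul_nonneg_of_real {c : ℝ} (hc : 0 ≤ c) {f : LInf ν} (hf : 0 ≤ f) :
    0 ≤ (c : ℂ) • f := by
  rw [nonneg_iff] at *
  filter_upwards [hf, Lp.coeFn_smul (c : ℂ) f] with x h1 h2
  rw [h2, Pi.smul_apply, smul_eq_mul]
  exact mul_nonneg (Complex.zero_le_real.2 hc) h1

theorem linfMul_le_linfMul_of_nonneg_left {a b c : LInf ν} (hc : 0 ≤ c) (h : a ≤ b) :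
    linfMul c a ≤ linfMul c b := by
  have h1 := linfMul_nonneg hc (sub_nonneg.2 h)
  have h2 := (linfMulLeft c).map_sub b a
  simp only [linfMulLeft_apply] at h2
  rwa [h2, sub_nonneg] at h1

theorem norm_le_one_of_nonneg_of_le_one {h : LInf ν} (h0 : 0 ≤ h) (h1 : h ≤ linfOne ν) :
    ‖h‖ ≤ 1 := by
  refine norm_le_of_ae_le zero_le_one ?_
  filter_upwards [nonneg_iff.1 h0, le_iff.1 h1, coeFn_linfOne ν] with x h2 h3 h4
  rw [h4] at h3
  have h5 : h x = ((h x).re : ℂ) := Complex.ext rfl (by simpa using (Complex.le_def.1 h2).2.symm)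
  rw [h5, Complex.norm_real, Real.norm_eq_abs, abs_of_nonneg (Complex.le_def.1 h2).1]
  exact (Complex.le_def.1 h3).1

/-- Linear maps that agree on nonnegative functions are equal. -/
theorem linearMap_ext_nonneg {P Q : LInf ν →ₗ[ℂ] LInf ρ} (h : ∀ f, 0 ≤ f → P f = Q f)
    (f : LInf ν) : P f = Q f := by
  have h0 {c : ℝ} (hc : 0 ≤ c) : 0 ≤ (c : ℂ) • linfOne ν := smul_nonneg_of_real hc linfOne_nonneg
  have hsa {g : LInf ν} (hg : star g = g) : P g = Q g := by
    have h1 := h _ (sub_nonneg.2 (le_norm_smul_one hg))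
    have h2 := h _ (h0 (norm_nonneg g))
    rw [map_sub, map_sub, h2] at h1
    exact sub_right_injective h1
  have h1 : P (f + star f) = Q (f + star f) :=
    hsa (by rw [linf_star_add, star_star, add_comm])
  have h2 : P (Complex.I • (f - star f)) = Q (Complex.I • (f - star f)) := by
    refine hsa ?_
    rw [linf_star_smul, linf_star_sub, star_star]
    simp only [Complex.star_def, Complex.conj_I, neg_smul, ← smul_neg, neg_sub]
  rw [map_smul, map_smul] at h2
  have h3 := smul_right_injective _ Complex.I_ne_zero h2
  have h4 : f + f = (f + star f) + (f - star f) := by abel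
  have h5 : (2 : ℂ) • P f = (2 : ℂ) • Q f := by
    rw [two_smul, two_smul, ← map_add, ← map_add, h4, map_add P (f + star f),
      map_add Q (f + star f), h1]
    exact congrArg _ h3
  exact smul_right_injective _ two_ne_zero h5

variable {X : Type*} [MeasurableSpace X] {μ : Measure X}

/-- The `a i` need only be nonnegative up to an error that vanishes in the limit, separately on each
set `s`; self-adjointness removes the imaginary part. This weak form is what an almost maximizing
sequence provides. -/
theorem UltraweakTendsto.nonneg [IsFiniteMeasure μ] {I : Type*} {l : Filter I} [l.NeBot]
    {a : I → LInf μ} {b : LInf μ} (h : UltraweakTendsto a l b) (ha : ∀ i, star (a i) = a i)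
    (hs : ∀ s, MeasurableSet s → ∃ ε : I → ℝ, Tendsto ε l (𝓝 0) ∧
      ∀ i, ε i ≤ (∫ x in s, a i x ∂μ).re) : 0 ≤ b := by
  refine nonneg_of_setIntegral_nonneg fun s hsm => ?_
  have h1 := h.setIntegral hsm
  obtain ⟨ε, hε, hle⟩ := hs s hsm
  refine Complex.le_def.2 ⟨?_, ?_⟩
  · exact le_of_tendsto_of_tendsto' hε (Complex.continuous_re.continuousAt.tendsto.comp h1) hle
  · refine (tendsto_nhds_unique (Complex.continuous_im.continuousAt.tendsto.comp h1)
      (tendsto_const_nhds.congr fun i => ?_)).symm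
    have hi : Integrable (a i) μ := by
      simpa using integrable_coeFn_mul (a i) (integrable_const (1 : ℂ))
    have h2 : ∫ x in s, (a i x).im ∂μ = (∫ x in s, a i x ∂μ).im :=
      integral_im (𝕜 := ℂ) hi.integrableOn
    rw [Function.comp_apply, ← h2, integral_eq_zero_of_ae, Complex.zero_im]
    refine ae_restrict_of_ae ?_
    filter_upwards [coeFn_star_apply (a i)] with x hx
    rw [ha i] at hx
    exact Complex.conj_eq_iff_im.1 hx.symm

theorem UltraweakTendsto.nonneg_of_nonneg [IsFiniteMeasure μ] {I : Type*} {l : Filter I}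
    [l.NeBot] {a : I → LInf μ} {b : LInf μ} (h : UltraweakTendsto a l b) (ha : ∀ i, 0 ≤ a i) :
    0 ≤ b := by
  refine h.nonneg (fun i => star_eq_self_of_nonneg (ha i)) fun s _ =>
    ⟨fun _ => 0, tendsto_const_nhds, fun i => ?_⟩
  have hi : Integrable (a i) μ := by
    simpa using integrable_coeFn_mul (a i) (integrable_const (1 : ℂ))
  have h2 : ∫ x in s, (a i x).re ∂μ = (∫ x in s, a i x ∂μ).re :=
    integral_re (𝕜 := ℂ) hi.integrableOn
  rw [← h2]
  refine integral_nonneg_of_ae (ae_restrict_of_ae ?_)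
  filter_upwards [nonneg_iff.1 (ha i)] with x hx using (Complex.le_def.1 hx).1

end PositivePart

/-! ### Contractivity of positive module maps, and symmetrization. -/

section Maps

variable {Γ : Type u} {X : Type v} [Group Γ] [Countable Γ] [MeasurableSpace Γ]
  [DiscreteMeasurableSpace Γ] [MeasurableSpace X] [MulAction Γ X] [MeasurableConstSMul Γ X]
  {μ : Measure X} [IsProbabilityMeasure μ]

/-- For contractivity, multiply `ξ` by the conjugate phase `v` of `P ξ`. Module linearity gives `P
(v ξ) = |P ξ|`, so the real part `r` of `v ξ` satisfies `P r = |P ξ|`, while `r ≤ ‖r‖ • 1` and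
positivity bound `P r` by `‖r‖ ≤ ‖ξ‖`. -/
theorem isConditionalExpectation_of_isPositive (P : LInf (prodMeasure Γ μ) →ₗ[ℂ] LInf μ)
    (hP : IsPositive P) (h1 : IsUnital P) (hm : IsModuleMap P) : IsConditionalExpectation P where
  emb_eq a := by rw [← linfMul_one (emb Γ μ a), hm, h1, linfMul_one]
  positive := hP
  module_map := hm
  contractive ξ := by
    set u : X → ℂ := fun x => star (P ξ x) / ‖P ξ x‖
    have hum : Measurable u := (continuous_star.measurable.comp (measurable_coeFn (P ξ))).div
      (Complex.measurable_ofReal.comp (measurable_coeFn (P ξ)).norm)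
    have hu1 (x : X) : ‖u x‖ ≤ 1 := by
      simp only [u, norm_div, norm_star, Complex.norm_real, norm_norm]
      exact div_self_le_one _
    set v : LInf μ := linfMk μ u hum 1 hu1
    set w := linfMul (emb Γ μ v) ξ
    have hv : ‖v‖ ≤ 1 := norm_le_of_ae_le zero_le_one (by
      filter_upwards [coeFn_linfMk (ν := μ) u hum 1 hu1] with x hx
      rw [hx]
      exact hu1 x)
    have hw : ‖w‖ ≤ ‖ξ‖ := (norm_linfMul_le _ _).trans (mul_le_of_le_one_left (norm_nonneg _)
      ((norm_linfComp_le _ _ v).trans hv))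
    set r := (2⁻¹ : ℂ) • (w + star w)
    have hr : star r = r := by
      rw [linf_star_smul, linf_star_add, star_star, add_comm]
      simp [r]
    have hrn : ‖r‖ ≤ ‖ξ‖ := by
      rw [norm_smul]
      have h2 := norm_add_le w (star w)
      rw [norm_linf_star] at h2
      norm_num
      linarith
    have hPr : P r ≤ ((‖r‖ : ℝ) : ℂ) • linfOne μ := by
      have e1 := map_le_map_of_positive hP (le_norm_smul_one hr)
      have e2 : P (((‖r‖ : ℝ) : ℂ) • linfOne (prodMeasure Γ μ)) = ((‖r‖ : ℝ) : ℂ) • linfOne μ := by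
        rw [map_smul, h1]
      rwa [e2] at e1
    have hPw : P w = linfMul v (P ξ) := hm v ξ
    have hPr' : P r = (2⁻¹ : ℂ) • (P w + star (P w)) := by
      rw [map_smul, map_add, star_map_of_positive hP]
    refine norm_le_of_ae_le (norm_nonneg ξ) ?_
    filter_upwards [le_iff.1 hPr, coeFn_linfMul v (P ξ), coeFn_linfMk (ν := μ) u hum 1 hu1,
      Lp.coeFn_smul (2⁻¹ : ℂ) (P w + star (P w)), Lp.coeFn_add (P w) (star (P w)),
      coeFn_star_apply (P w), Lp.coeFn_smul ((‖r‖ : ℝ) : ℂ) (linfOne μ), coeFn_linfOne μ]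
      with x e1 e2 e3 e4 e5 e6 e7 e8
    have e9 : P w x = ((‖P ξ x‖ : ℝ) : ℂ) := by
      rw [hPw, e2, e3]
      by_cases h0 : P ξ x = 0
      · simp [h0]
      · have h0' : ((‖P ξ x‖ : ℝ) : ℂ) ≠ 0 := by simpa using h0
        simp only [u]
        rw [div_mul_eq_mul_div, div_eq_iff h0', Complex.star_def, Complex.conj_mul']
        ring
    rw [hPr', e4, Pi.smul_apply, e5, Pi.add_apply, e6, e9, e7, Pi.smul_apply, e8] at e1
    have e10 := (Complex.le_def.1 e1).1
    simp at e10
    linarith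

variable [QuasiInvariant Γ μ]

/-- The average of `P` and `f ↦ star (P (star f))` works, because the involution commutes with the
action and with the embedding of `L^∞(X)`. -/
theorem exists_isStarPreserving (P : LInf (prodMeasure Γ μ) →L[ℂ] LInf μ) (h1 : IsUnital P)
    (hm : IsModuleMap P) (he : IsEquivariant P) :
    ∃ Q : LInf (prodMeasure Γ μ) →L[ℂ] LInf μ,
      IsStarPreserving Q ∧ IsUnital Q ∧ IsModuleMap Q ∧ IsEquivariant Q := by
  let Q : LInf (prodMeasure Γ μ) →L[ℂ] LInf μ := LinearMap.mkContinuous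
    { toFun := fun f => (2⁻¹ : ℂ) • (P f + star (P (star f)))
      map_add' := fun f g => by
        rw [linf_star_add, map_add, map_add, linf_star_add, ← smul_add]
        congr 1
        abel
      map_smul' := fun z f => by
        rw [linf_star_smul, map_smul, map_smul, linf_star_smul, star_star, ← smul_add, smul_comm,
          RingHom.id_apply] } ‖P‖ fun f => by
    have e1 := P.le_opNorm f
    have e2 := P.le_opNorm (star f)
    have e3 := norm_add_le (P f) (star (P (star f)))
    rw [norm_linf_star] at e2 e3
    simp only [LinearMap.coe_mk, AddHom.coe_mk, norm_smul]
    norm_num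
    linarith
  have hQ (f) : Q f = (2⁻¹ : ℂ) • (P f + star (P (star f))) := rfl
  have half (a : LInf μ) : (2⁻¹ : ℂ) • (a + a) = a := by
    rw [← two_smul ℂ, smul_smul]
    norm_num
  refine ⟨Q, fun f => ?_, ?_, fun a f => ?_, fun g f => ?_⟩
  · rw [hQ, hQ, linf_star_smul, linf_star_add, star_star, star_star, add_comm]
    simp
  · rw [IsUnital, hQ, star_linfOne, h1, star_linfOne, half]
  · have h2 : star (emb Γ μ a) = emb Γ μ (star a) := (linfComp_star _ _ a).symm
    rw [hQ, hQ, star_linfMul, h2, hm, hm, star_linfMul, star_star, linfMul_smul, linfMul_add]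
  · have h2 : star (actProd μ g f) = actProd μ g (star f) := (linfComp_star _ _ f).symm
    have h3 : star (act μ g (P (star f))) = act μ g (star (P (star f))) :=
      (linfComp_star _ _ _).symm
    rw [hQ, hQ, h2, he, he, h3, ← actₗ_apply, ← actₗ_apply, ← actₗ_apply, ← map_add, ← map_smul]

end Maps

/-! ### The least positive majorant and its normalization. -/

section JordanDecomposition

variable {α : Type*} [MeasurableSpace α] {ν : Measure α}

theorem le_one_of_nonneg_of_norm_le_one {h : LInf ν} (h0 : 0 ≤ h) (h1 : ‖h‖ ≤ 1) :
    h ≤ linfOne ν := by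
  rw [le_iff]
  filter_upwards [nonneg_iff.1 h0, ae_norm_le_norm h, coeFn_linfOne ν] with x h2 h3 h4
  rw [h4]
  refine Complex.le_def.2 ⟨(Complex.re_le_norm _).trans (h3.trans h1), ?_⟩
  simpa using (Complex.le_def.1 h2).2.symm

theorem linfMul_sub (a b c : LInf ν) : linfMul a (b - c) = linfMul a b - linfMul a c :=
  (linfMulLeft a).map_sub b c

/-- The integral over a finite measure as a linear functional. -/
def linfIntegral {X : Type*} [MeasurableSpace X] (μ : Measure X) [IsFiniteMeasure μ] :
    LInf μ →ₗ[ℂ] ℂ where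
  toFun a := ∫ x, a x ∂μ
  map_add' a b := by
    have h (c : LInf μ) : Integrable c μ := by
      simpa using integrable_coeFn_mul c (integrable_const (1 : ℂ))
    rw [← integral_add (h a) (h b)]
    exact integral_congr_ae (Lp.coeFn_add a b)
  map_smul' z a := by
    rw [RingHom.id_apply, ← integral_smul]
    exact integral_congr_ae (Lp.coeFn_smul z a)

theorem linfIntegral_ind_mul {X : Type*} [MeasurableSpace X] (μ : Measure X) [IsFiniteMeasure μ]
    {s : Set X} (hs : MeasurableSet s) (a : LInf μ) :
    linfIntegral μ (linfMul (linfInd μ s hs) a) = ∫ x in s, a x ∂μ := by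
  rw [← integral_mul_indicator a hs]
  refine integral_congr_ae ?_
  filter_upwards [coeFn_linfMul (linfInd μ s hs) a, coeFn_linfInd (ν := μ) s hs] with x h1 h2
  rw [h1, h2, mul_comm]

theorem norm_linfInd_le (s : Set α) (hs : MeasurableSet s) : ‖linfInd ν s hs‖ ≤ 1 :=
  norm_le_one_of_nonneg_of_le_one (linfInd_nonneg s hs) (linfInd_le_one s hs)

variable {Γ : Type u} {X : Type v} [Group Γ] [Countable Γ] [MeasurableSpace Γ]
  [DiscreteMeasurableSpace Γ] [MeasurableSpace X] [MulAction Γ X] [MeasurableConstSMul Γ X]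
  {μ : Measure X} [IsProbabilityMeasure μ]

/-- A bounded star-preserving module map has a least positive majorant, which is again a bounded
module map. -/
theorem exists_least_positive_majorant (P : LInf (prodMeasure Γ μ) →L[ℂ] LInf μ)
    (hstar : IsStarPreserving P) (hm : IsModuleMap P) :
    ∃ Q : LInf (prodMeasure Γ μ) →L[ℂ] LInf μ, IsModuleMap Q ∧ IsPositive Q ∧
      (∀ f, 0 ≤ f → P f ≤ Q f) ∧
      ∀ R : LInf (prodMeasure Γ μ) →ₗ[ℂ] LInf μ, IsPositive R → (∀ f, 0 ≤ f → P f ≤ R f) →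
        ∀ f, 0 ≤ f → Q f ≤ R f := by
  set H : Set (LInf (prodMeasure Γ μ)) := {h | 0 ≤ h ∧ h ≤ linfOne _}
  set Φ : LInf (prodMeasure Γ μ) →ₗ[ℂ] ℂ := linfIntegral μ ∘ₗ (P : LInf _ →ₗ[ℂ] LInf μ)
  have hΦ (f) : Φ f = linfIntegral μ (P f) := rfl
  have hHnorm {h} (hh : h ∈ H) : ‖h‖ ≤ 1 := norm_le_one_of_nonneg_of_le_one hh.1 hh.2
  have hbdd : BddAbove ((fun h => (Φ h).re) '' H) := by
    refine ⟨‖P‖, ?_⟩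
    rintro _ ⟨h, hh, rfl⟩
    have h1 := norm_integral_coeFn_mul_le (P h) (integrable_const (1 : ℂ))
    simp only [mul_one, norm_one, integral_const, smul_eq_mul, probReal_univ] at h1
    exact (Complex.re_le_norm _).trans (h1.trans ((P.le_opNorm h).trans
      (mul_le_of_le_one_right (norm_nonneg P) (hHnorm hh))))
  have hne : ((fun h => (Φ h).re) '' H).Nonempty :=
    ⟨_, 0, ⟨le_rfl, linfOne_nonneg⟩, rfl⟩
  set M := sSup ((fun h => (Φ h).re) '' H)
  set ε : ℕ → ℝ := fun n => 1 / ((n : ℝ) + 1)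
  have hε0 (n : ℕ) : 0 < ε n := by positivity
  have hε : Tendsto ε atTop (𝓝 0) := tendsto_one_div_add_atTop_nhds_zero_nat
  have hM {h} (hh : h ∈ H) : (Φ h).re ≤ M := le_csSup hbdd ⟨h, hh, rfl⟩
  have hex (n : ℕ) : ∃ h ∈ H, M - ε n < (Φ h).re := by
    obtain ⟨_, ⟨h, hh, rfl⟩, h1⟩ := exists_lt_of_lt_csSup hne (sub_lt_self M (hε0 n))
    exact ⟨h, hh, h1⟩
  choose h hH hh using hex
  have hmul_le {k} (hk : k ∈ H) {f : LInf (prodMeasure Γ μ)} (hf : 0 ≤ f) :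
      linfMul k f ≤ f := by
    have := linfMul_le_linfMul_of_nonneg_left hf hk.2
    rwa [linfMul_one, linfMul_comm] at this
  -- Removing `k * h n` from `h n` stays in `H`, so it cannot raise `Re Φ` by more than `ε n`: `Φ`
  -- is almost nonnegative below `h n`.
  have hA {k} (hk : k ∈ H) (n : ℕ) : -ε n ≤ (Φ (linfMul k (h n))).re := by
    have h1 := hM (h := h n - linfMul k (h n)) ⟨sub_nonneg.2 (hmul_le hk (hH n).1),
      (sub_le_self _ (linfMul_nonneg hk.1 (hH n).1)).trans (hH n).2⟩
    rw [map_sub, Complex.sub_re] at h1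
    linarith [hh n]
  -- Likewise adding `k * (1 - h n)` to `h n` stays in `H`: `Φ` is almost nonpositive below `1 - h
  -- n`.
  have hB {k} (hk : k ∈ H) (n : ℕ) : (Φ (k - linfMul k (h n))).re ≤ ε n := by
    have h0 : linfMul k (linfOne _ - h n) = k - linfMul k (h n) := by
      rw [linfMul_sub, linfMul_one]
    have h2 : 0 ≤ linfOne _ - h n := sub_nonneg.2 (hH n).2
    have h1 := hM (h := h n + (k - linfMul k (h n))) ⟨add_nonneg (hH n).1
      (h0 ▸ linfMul_nonneg hk.1 h2), by
        have := add_le_add (le_refl (h n)) (hmul_le hk h2)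
        rwa [h0, add_sub_cancel] at this⟩
    rw [map_add, Complex.add_re] at h1
    linarith [hh n]
  -- Restricting `f` to `Γ × s` localizes the scalar estimates `hA` and `hB` to integrals over `s`;
  -- this is how `Φ` controls the `L^∞(X)`-valued map `P`. The scale `‖f‖ + 1` brings `f` below `1`
  -- and is never zero.
  have hcut {f : LInf (prodMeasure Γ μ)} (hf : 0 ≤ f) {s : Set X} (hs : MeasurableSet s) :
      (((‖f‖ + 1)⁻¹ : ℝ) : ℂ) • linfMul (emb Γ μ (linfInd μ s hs)) f ∈ H := by
    have h1 : 0 ≤ (((‖f‖ + 1)⁻¹ : ℝ) : ℂ) • linfMul (emb Γ μ (linfInd μ s hs)) f :=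
      smul_nonneg_of_real (by positivity) (linfMul_nonneg (emb_nonneg (linfInd_nonneg s hs)) hf)
    refine ⟨h1, le_one_of_nonneg_of_norm_le_one h1 ?_⟩
    rw [norm_smul, Complex.norm_real, Real.norm_of_nonneg (by positivity), inv_mul_le_iff₀
      (by positivity), mul_one]
    refine (norm_linfMul_le _ _).trans ((mul_le_of_le_one_left (norm_nonneg f)
      ((norm_linfComp_le _ _ _).trans (norm_linfInd_le s hs))).trans (by linarith))
  have hΦcut (c : ℝ) (s : Set X) (hs : MeasurableSet s) (f : LInf (prodMeasure Γ μ)) :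
      (Φ ((c : ℂ) • linfMul (emb Γ μ (linfInd μ s hs)) f)).re
        = c * (∫ x in s, P f x ∂μ).re := by
    rw [map_smul, hΦ, hm, linfIntegral_ind_mul, smul_eq_mul, Complex.re_ofReal_mul]
  have hsmul_mul (c : ℂ) (a f g : LInf (prodMeasure Γ μ)) :
      linfMul (c • linfMul a f) g = c • linfMul a (linfMul g f) := by
    rw [linfMul_comm, linfMul_smul, linfMul_comm, linfMul_assoc, linfMul_comm f g]
  set U : Ultrafilter ℕ := hyperfilter ℕ
  have hU : (U : Filter ℕ) ≤ atTop := Nat.hyperfilter_le_atTop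
  obtain ⟨Q, hQ⟩ := exists_linearMap_ultraweakTendsto U
    (fun n => (P : LInf (prodMeasure Γ μ) →ₗ[ℂ] LInf μ) ∘ₗ linfMulLeft (h n)) ‖P‖ fun n f => by
      refine (P.le_opNorm _).trans ?_
      gcongr
      exact (norm_linfMul_le _ _).trans (mul_le_of_le_one_left (norm_nonneg f) (hHnorm (hH n)))
  have hQ (f) : UltraweakTendsto (fun n => P (linfMul (h n) f)) U (Q f) := hQ f
  have hconst (b : LInf μ) : UltraweakTendsto (fun _ : ℕ => b) U b :=
    fun φ _ => tendsto_const_nhds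
  have hsa {f} (hf : 0 ≤ f) : star (P f) = P f := by
    rw [← hstar, star_eq_self_of_nonneg hf]
  have hεlim (c : ℝ) : Tendsto (fun n => -(c * ε n)) U (𝓝 0) := by
    simpa using ((hε.mono_left hU).const_mul c).neg
  refine ⟨Q, fun a f => ?_, fun f hf => ?_, fun f hf => ?_, fun R hR hPR f hf => ?_⟩
  · refine (hQ _).unique ?_
    refine (iff_of_eq (congrArg (UltraweakTendsto · _ _) (funext fun n => ?_))).1
      ((hQ f).linfMul a)
    rw [← hm, ← linfMul_assoc, linfMul_comm (emb Γ μ a), linfMul_assoc]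
  · refine (hQ f).nonneg (fun n => hsa (linfMul_nonneg (hH n).1 hf)) fun s hs =>
      ⟨_, hεlim (‖f‖ + 1), fun n => ?_⟩
    have h1 := hA (hcut hf hs) n
    rw [hsmul_mul, hΦcut, inv_mul_eq_div, le_div_iff₀ (by positivity)] at h1
    linarith
  · rw [← sub_nonneg]
    refine ((hQ f).sub (hconst (P f))).nonneg (fun n => ?_) fun s hs =>
      ⟨_, hεlim (‖f‖ + 1), fun n => ?_⟩
    · rw [linf_star_sub, hsa hf, hsa (linfMul_nonneg (hH n).1 hf)]
    · have h1 := hB (hcut hf hs) n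
      rw [hsmul_mul, ← smul_sub, ← linfMul_sub, hΦcut, inv_mul_eq_div,
        div_le_iff₀ (by positivity), map_sub] at h1
      have h2 : ∫ x in s, (P f - P (linfMul (h n) f) : LInf μ) x ∂μ
          = - ∫ x in s, (P (linfMul (h n) f) - P f : LInf μ) x ∂μ := by
        rw [← linfIntegral_ind_mul μ hs, ← linfIntegral_ind_mul μ hs, ← map_neg, linfMul_sub,
          linfMul_sub, neg_sub]
      rw [h2, Complex.neg_re] at h1
      linarith
  -- Leastness: `P (h n * f) ≤ R (h n * f) ≤ R f` for each `n`, and the inequality survives the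
  -- limit.
  · rw [← sub_nonneg]
    refine ((hconst (R f)).sub (hQ f)).nonneg_of_nonneg fun n => ?_
    have h1 : P (linfMul (h n) f) ≤ R (linfMul (h n) f) := hPR _ (linfMul_nonneg (hH n).1 hf)
    have h2 : R (linfMul (h n) f) ≤ R f := map_le_map_of_positive hR (hmul_le (hH n) hf)
    exact sub_nonneg.2 (h1.trans h2)

variable [QuasiInvariant Γ μ]

/-- Normalizing the least positive majorant of an equivariant map. -/
theorem exists_isPositive (P : LInf (prodMeasure Γ μ) →L[ℂ] LInf μ)
    (hstar : IsStarPreserving P) (h1 : IsUnital P) (hm : IsModuleMap P) (he : IsEquivariant P) :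
    ∃ Q : LInf (prodMeasure Γ μ) →ₗ[ℂ] LInf μ,
      IsPositive Q ∧ IsUnital Q ∧ IsModuleMap Q ∧ IsEquivariant Q := by
  obtain ⟨Q, hQm, hQpos, hPQ, hQmin⟩ := exists_least_positive_majorant P hstar hm
  have act_mono (g : Γ) {a b : LInf μ} (hab : a ≤ b) : act μ g a ≤ act μ g b :=
    map_le_map_of_positive (P := actₗ g) (fun f hf => act_nonneg g hf) hab
  have actProd_inv (g : Γ) (f : LInf (prodMeasure Γ μ)) :
      actProd μ g⁻¹ (actProd μ g f) = f := by
    simpa only [inv_inv] using actProd_actProd_inv g⁻¹ f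
  have act_inv (g : Γ) (a : LInf μ) : act μ g⁻¹ (act μ g a) = a := by
    simpa only [inv_inv] using act_act_inv g⁻¹ a
  have hle (g : Γ) {f : LInf (prodMeasure Γ μ)} (hf : 0 ≤ f) :
      Q f ≤ act μ g⁻¹ (Q (actProd μ g f)) := by
    -- Conjugating `Q` by `g` gives another positive majorant of the equivariant map `P`, so
    -- leastness applies. Using this for `g` and `g⁻¹` yields both inequalities of equivariance.
    refine hQmin (actₗ g⁻¹ ∘ₗ (Q : LInf (prodMeasure Γ μ) →ₗ[ℂ] LInf μ) ∘ₗ actProdₗ g)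
      (fun f hf => act_nonneg g⁻¹ (hQpos _ (actProd_nonneg g hf))) (fun f hf => ?_) f hf
    have := act_mono g⁻¹ (hPQ _ (actProd_nonneg g hf))
    rwa [he, act_inv] at this
  have hQe : IsEquivariant Q := by
    intro g
    refine linearMap_ext_nonneg (P := (Q : LInf (prodMeasure Γ μ) →ₗ[ℂ] LInf μ) ∘ₗ actProdₗ g)
      (Q := actₗ g ∘ₗ (Q : LInf (prodMeasure Γ μ) →ₗ[ℂ] LInf μ)) fun f hf => ?_
    refine le_antisymm ?_ ?_
    · have := hle g⁻¹ (actProd_nonneg g hf)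
      rwa [actProd_inv, inv_inv] at this
    · have := act_mono g (hle g hf)
      rwa [act_act_inv] at this
  set d := Q (linfOne _)
  have hd : linfOne μ ≤ d := by
    have := hPQ _ linfOne_nonneg
    rwa [h1] at this
  have hd1 : ∀ᵐ x ∂μ, 1 ≤ d x := by
    filter_upwards [le_iff.1 hd, coeFn_linfOne μ] with x h2 h3
    rwa [h3] at h2
  have hinv : MemLp (fun x => (d x)⁻¹) ∞ μ := by
    refine memLp_top_of_bound (measurable_coeFn d).inv.aestronglyMeasurable 1 ?_
    filter_upwards [hd1] with x hx
    rw [norm_inv]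
    exact inv_le_one_of_one_le₀ (((Complex.le_def.1 hx).1).trans (Complex.re_le_norm _))
  set e : LInf μ := hinv.toLp _
  have he0 : 0 ≤ e := by
    rw [nonneg_iff]
    filter_upwards [hd1, hinv.coeFn_toLp] with x hx h2
    rw [h2]
    exact inv_nonneg.2 (zero_le_one.trans hx)
  have hed : linfMul e d = linfOne μ := by
    apply Lp.ext
    filter_upwards [hd1, hinv.coeFn_toLp, coeFn_linfMul e d, coeFn_linfOne μ] with x hx h2 h3 h4
    rw [h3, h2, h4]
    exact inv_mul_cancel₀ (zero_lt_one.trans_le hx).ne'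
  have hact_d (g : Γ) : act μ g d = d := by
    rw [← hQe, actProd_one]
  -- The function `d` is invariant, and both `e` and its translate are inverse to it.
  have hact_e (g : Γ) : act μ g e = e := by
    have h2 : linfMul (act μ g e) d = linfOne μ := by
      rw [← hact_d g, ← act_mul, hed, act_one]
    rw [← linfMul_one (act μ g e), ← hed, linfMul_comm e d, ← linfMul_assoc, h2, one_linfMul]
  refine ⟨linfMulLeft e ∘ₗ (Q : LInf (prodMeasure Γ μ) →ₗ[ℂ] LInf μ),
    fun f hf => linfMul_nonneg he0 (hQpos f hf), hed, fun a f => ?_, fun g f => ?_⟩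
  · change linfMul e (Q _) = linfMul a (linfMul e (Q f))
    rw [hQm, ← linfMul_assoc, ← linfMul_assoc, linfMul_comm e a]
  · change linfMul e (Q _) = act μ g (linfMul e (Q f))
    rw [hQe, act_mul, hact_e]

end JordanDecomposition

/-! ### Approximating positive module maps by finitely supported maps. -/

section Approximation

/-- Finitely many essentially bounded functions can be approximated simultaneously by simple
functions with common level sets. -/
theorem exists_common_simpleFunc {α : Type*} [MeasurableSpace α] {ν : Measure α}
    (F : Finset (LInf ν)) {ε : ℝ} (hε : 0 < ε) :
    ∃ s : SimpleFunc α (F → ℂ), ∀ᵐ y ∂ν, ∀ f : F, ‖(f : LInf ν) y - s y f‖ ≤ ε := by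
  set R : ℝ := ∑ f ∈ F, ‖f‖
  have hR (f : F) : ‖(f : LInf ν)‖ ≤ R :=
    Finset.single_le_sum (f := fun f : LInf ν => ‖f‖) (fun _ _ => norm_nonneg _) f.2
  have hR0 : 0 ≤ R := Finset.sum_nonneg fun _ _ => norm_nonneg _
  let v : α → F → ℂ := fun y f => (f : LInf ν) y
  have hv : Measurable v := measurable_pi_lambda _ fun f => measurable_coeFn (f : LInf ν)
  let e : ℕ → F → ℂ := TopologicalSpace.denseSeq (F → ℂ)
  -- The functions in `F` form one vector-valued function with values a.e. in a compact ball.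
  -- Finitely many points of a dense sequence are `ε`-dense there, and rounding to the nearest of
  -- them gives the simple function.
  obtain ⟨t, ht⟩ := (isCompact_closedBall (0 : F → ℂ) R).elim_finite_subcover
    (fun n => Metric.ball (e n) ε) (fun _ => Metric.isOpen_ball) fun z _ => by
      obtain ⟨n, hn⟩ := (TopologicalSpace.denseRange_denseSeq (F → ℂ)).exists_dist_lt z hε
      exact Set.mem_iUnion.2 ⟨n, hn⟩
  set N := t.sup id
  refine ⟨(SimpleFunc.nearestPt e N).comp v hv, ?_⟩
  have hb : ∀ᵐ y ∂ν, ∀ f : F, ‖(f : LInf ν) y‖ ≤ ‖(f : LInf ν)‖ :=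
    ae_all_iff.2 fun f => ae_norm_le_norm (f : LInf ν)
  filter_upwards [hb] with y hy f
  have hvy : v y ∈ Metric.closedBall (0 : F → ℂ) R := by
    rw [mem_closedBall_zero_iff, pi_norm_le_iff_of_nonneg hR0]
    exact fun f => (hy f).trans (hR f)
  obtain ⟨n, hn, hn'⟩ := Set.mem_iUnion₂.1 (ht hvy)
  have h1 : dist (SimpleFunc.nearestPt e N (v y)) (v y) ≤ dist (e n) (v y) := by
    rw [dist_edist, dist_edist]
    exact ENNReal.toReal_mono (edist_ne_top _ _)
      (SimpleFunc.edist_nearestPt_le e (v y) (Finset.le_sup (f := id) hn))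
  have h2 := (dist_le_pi_dist (SimpleFunc.nearestPt e N (v y)) (v y) f).trans h1
  rw [dist_comm (e n), dist_comm, dist_eq_norm] at h2
  exact h2.trans (Metric.mem_ball.1 hn').le

variable {Γ : Type u} {X : Type v} [Group Γ] [Countable Γ] [MeasurableSpace Γ]
  [DiscreteMeasurableSpace Γ] [MeasurableSpace X] [MulAction Γ X] [MeasurableConstSMul Γ X]
  {μ : Measure X} [IsProbabilityMeasure μ]

theorem coeFn_total (p : Γ →₀ LInf μ) : ∀ᵐ x ∂μ, total p x = ∑ g ∈ p.support, p g x :=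
  coeFn_finset_sum p.support p

theorem ae_sum_norm_le_one {p : Γ →₀ LInf μ} (hp : ∀ g, 0 ≤ p g) (h1 : total p ≤ linfOne μ) :
    ∀ᵐ x ∂μ, ∑ g ∈ p.support, ‖p g x‖ ≤ 1 := by
  have hp' : ∀ᵐ x ∂μ, ∀ g, 0 ≤ p g x := ae_all_iff.2 fun g => nonneg_iff.1 (hp g)
  filter_upwards [hp', le_iff.1 h1, coeFn_total p, coeFn_linfOne μ] with x h2 h3 h4 h5
  rw [h4, h5] at h3
  have h6 : ∑ g ∈ p.support, ‖p g x‖ = (∑ g ∈ p.support, p g x).re := by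
    rw [Complex.re_sum]
    refine Finset.sum_congr rfl fun g _ => ?_
    have h7 : p g x = ((p g x).re : ℂ) :=
      Complex.ext rfl (by simpa using (Complex.le_def.1 (h2 g)).2.symm)
    conv_lhs => rw [h7]
    rw [Complex.norm_real, Real.norm_eq_abs, abs_of_nonneg (Complex.le_def.1 (h2 g)).1]
  rw [h6]
  exact (Complex.le_def.1 h3).1

/-- The set of points `x` such that `g` is the first element with `s (g, x) = k`, with respect to
the enumeration `e`. -/
def firstHit {K : Type*} (s : SimpleFunc (Γ × X) K) (e : Γ → ℕ) (k : K) (g : Γ) : Set X :=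
  {x | s (g, x) = k ∧ ∀ g', e g' < e g → s (g', x) ≠ k}

theorem measurableSet_fiber {K : Type*} (s : SimpleFunc (Γ × X) K) (k : K) (g : Γ) :
    MeasurableSet {x | s (g, x) = k} :=
  (measurable_prodMk_left (x := g)) (s.measurableSet_fiber k)

theorem measurableSet_firstHit {K : Type*} (s : SimpleFunc (Γ × X) K) (e : Γ → ℕ) (k : K)
    (g : Γ) : MeasurableSet (firstHit s e k g) := by
  refine (measurableSet_fiber s k g).inter ?_
  have h : {x | ∀ g', e g' < e g → s (g', x) ≠ k}
      = ⋂ g', ⋂ _ : e g' < e g, {x | s (g', x) = k}ᶜ := by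
    ext x
    simp
  change MeasurableSet {x | ∀ g', e g' < e g → s (g', x) ≠ k}
  rw [h]
  exact MeasurableSet.iInter fun g' => MeasurableSet.iInter fun _ =>
    (measurableSet_fiber s k g').compl

theorem firstHit_unique {K : Type*} {s : SimpleFunc (Γ × X) K} {e : Γ → ℕ}
    (he : Function.Injective e) {k : K} {g g' : Γ} {x : X} (h : x ∈ firstHit s e k g)
    (h' : x ∈ firstHit s e k g') : g = g' := by
  refine he (le_antisymm ?_ ?_)
  · exact not_lt.1 fun hlt => h.2 g' hlt h'.1
  · exact not_lt.1 fun hlt => h'.2 g hlt h.1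

theorem exists_mem_firstHit {K : Type*} {s : SimpleFunc (Γ × X) K} (e : Γ → ℕ)
    {k : K} {x : X} (h : ∃ g, s (g, x) = k) : ∃ g, x ∈ firstHit s e k g := by
  classical
  have hex : ∃ n, ∃ g, e g = n ∧ s (g, x) = k := by
    obtain ⟨g, hg⟩ := h
    exact ⟨e g, g, rfl, hg⟩
  obtain ⟨g, hg, hgk⟩ := Nat.find_spec hex
  refine ⟨g, hgk, fun g' hlt hk => ?_⟩
  rw [hg] at hlt
  exact Nat.find_min hex hlt ⟨g', rfl, hk⟩

/-- Positive unital module maps are approximated, on finitely many functions and in mean, by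
finitely supported maps. -/
theorem exists_finsupp_approx (P : LInf (prodMeasure Γ μ) →ₗ[ℂ] LInf μ) (hP : IsPositive P)
    (h1 : IsUnital P) (hm : IsModuleMap P) (F : Finset (LInf (prodMeasure Γ μ))) {ε : ℝ}
    (hε : 0 < ε) :
    ∃ p : Γ →₀ LInf μ, (∀ g, 0 ≤ p g) ∧ total p ≤ linfOne μ ∧
      ∀ f ∈ F, ∫ x, ‖(pairing p f - P f : LInf μ) x‖ ∂μ ≤ ε := by
  classical
  have hcontr := (isConditionalExpectation_of_isPositive P hP h1 hm).contractive
  -- Two `δ` bound the eventual pointwise error, and the third absorbs the integral of the excess.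
  set δ := ε / 3
  have hδ : 0 < δ := by positivity
  obtain ⟨s, hs⟩ := exists_common_simpleFunc F hδ
  obtain ⟨e, he⟩ := exists_injective_nat Γ
  let ind : (F → ℂ) → LInf (prodMeasure Γ μ) := fun k =>
    linfInd (prodMeasure Γ μ) (s ⁻¹' {k}) (s.measurableSet_fiber k)
  let q : (F → ℂ) → LInf μ := fun k => P (ind k)
  have hq0 (k) : 0 ≤ q k := hP _ (linfInd_nonneg _ _)
  have hind : ∀ᵐ y ∂(prodMeasure Γ μ), ∀ k ∈ s.range, ind k y = if s y = k then 1 else 0 := by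
    rw [Filter.eventually_all_finset]
    intro k _
    filter_upwards [coeFn_linfInd (ν := prodMeasure Γ μ) _ (s.measurableSet_fiber k)] with y hy
    rw [hy]
    simp [Set.indicator_apply]
  -- the weights sum to one and approximate `P`
  have happ (f : F) : ‖P f - ∑ k ∈ s.range, k f • q k‖ ≤ δ := by
    have h2 : P f - ∑ k ∈ s.range, k f • q k
        = P ((f : LInf (prodMeasure Γ μ)) - ∑ k ∈ s.range, k f • ind k) := by
      simp only [map_sub, map_sum, map_smul, q]
    rw [h2]
    refine (hcontr _).trans (norm_le_of_ae_le hδ.le ?_)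
    have h3 : ∀ᵐ y ∂(prodMeasure Γ μ), ∀ k ∈ s.range, (k f • ind k : LInf _) y = k f * ind k y := by
      rw [Filter.eventually_all_finset]
      exact fun k _ => Lp.coeFn_smul _ _
    filter_upwards [hs, hind, h3, coeFn_finset_sum s.range fun k => k f • ind k,
      Lp.coeFn_sub (f : LInf (prodMeasure Γ μ)) (∑ k ∈ s.range, k f • ind k)]
      with y h4 h5 h6 h7 h8
    rw [h8, Pi.sub_apply, h7, Finset.sum_congr rfl h6,
      Finset.sum_congr rfl fun k hk => congrArg (k f * ·) (h5 k hk)]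
    simpa [Finset.sum_ite_eq] using h4 f
  have hqsum : ∀ᵐ x ∂μ, ∑ k ∈ s.range, q k x = 1 := by
    have h2 : ∑ k ∈ s.range, q k = linfOne μ := by
      rw [← h1, ← map_sum]
      congr 1
      apply Lp.ext
      filter_upwards [hind, coeFn_finset_sum s.range ind, coeFn_linfOne (prodMeasure Γ μ)]
        with y h3 h4 h5
      rw [h4, h5, Finset.sum_congr rfl h3]
      simp
    filter_upwards [coeFn_finset_sum s.range q, coeFn_linfOne μ] with x h3 h4
    rw [← h3, h2, h4]
  have hq0' : ∀ᵐ x ∂μ, ∀ k ∈ s.range, 0 ≤ q k x := by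
    rw [Filter.eventually_all_finset]
    exact fun k _ => nonneg_iff.1 (hq0 k)
  -- Over the set of `x` whose section misses `k` the indicator of `s = k` is zero, and module
  -- linearity carries this to `q k`. Hence no mass is lost where there is no first hit.
  have hqzero : ∀ᵐ x ∂μ, ∀ k ∈ s.range, (∀ g, s (g, x) ≠ k) → q k x = 0 := by
    rw [Filter.eventually_all_finset]
    intro k _
    have hZ : MeasurableSet {x | ∀ g, s (g, x) ≠ k} := by
      have : {x | ∀ g, s (g, x) ≠ k} = ⋂ g, {x | s (g, x) = k}ᶜ := by
        ext x
        simp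
      exact this ▸ MeasurableSet.iInter fun g => (measurableSet_fiber s k g).compl
    have h2 : linfMul (emb Γ μ (linfInd μ _ hZ)) (ind k) = 0 := by
      apply Lp.ext
      filter_upwards [coeFn_linfMul (emb Γ μ (linfInd μ _ hZ)) (ind k),
        coeFn_linfInd (ν := prodMeasure Γ μ) _ (s.measurableSet_fiber k),
        coeFn_linfComp (fun p : Γ × X => p.2) Measure.quasiMeasurePreserving_snd
          (linfInd μ _ hZ),
        Measure.quasiMeasurePreserving_snd.ae (coeFn_linfInd (ν := μ) _ hZ),
        Lp.coeFn_zero ℂ ∞ (prodMeasure Γ μ)] with y h3 h4 h5 h6 h7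
      have h5' : emb Γ μ (linfInd μ _ hZ) y = linfInd μ _ hZ y.2 := h5
      rw [h3, h5', h6, h4, h7]
      by_cases hy : s y = k
      · have : y.2 ∉ {x | ∀ g, s (g, x) ≠ k} := fun h => h y.1 hy
        simp [this]
      · have : y ∉ s ⁻¹' {k} := hy
        simp [this]
    have h3 : linfMul (linfInd μ _ hZ) (q k) = 0 := by
      rw [← hm, h2, map_zero]
    filter_upwards [coeFn_linfMul (linfInd μ _ hZ) (q k), coeFn_linfInd (ν := μ) _ hZ,
      Lp.coeFn_zero ℂ ∞ μ] with x h4 h5 h6 hx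
    have hx' : x ∈ {x | ∀ g, s (g, x) ≠ k} := hx
    rw [h3, h6, h5, Set.indicator_of_mem hx', one_mul] at h4
    exact h4.symm
  -- the finitely supported maps
  let c : Γ → LInf μ := fun g =>
    ∑ k ∈ s.range, linfMul (q k) (linfInd μ _ (measurableSet_firstHit s e k g))
  have hc0 (g) : 0 ≤ c g :=
    Finset.sum_nonneg fun k _ => linfMul_nonneg (hq0 k) (linfInd_nonneg _ _)
  have hc : ∀ᵐ x ∂μ, ∀ g,
      c g x = ∑ k ∈ s.range, q k x * if x ∈ firstHit s e k g then 1 else 0 := by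
    rw [ae_all_iff]
    intro g
    have h2 : ∀ᵐ x ∂μ, ∀ k ∈ s.range,
        linfMul (q k) (linfInd μ _ (measurableSet_firstHit s e k g)) x
          = q k x * if x ∈ firstHit s e k g then 1 else 0 := by
      rw [Filter.eventually_all_finset]
      intro k _
      filter_upwards [coeFn_linfMul (q k) (linfInd μ _ (measurableSet_firstHit s e k g)),
        coeFn_linfInd (ν := μ) _ (measurableSet_firstHit s e k g)] with x h3 h4
      rw [h3, h4, Set.indicator_apply]
    filter_upwards [h2, coeFn_finset_sum s.range fun k =>
      linfMul (q k) (linfInd μ _ (measurableSet_firstHit s e k g))] with x h3 h4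
    exact h4.trans (Finset.sum_congr rfl h3)
  have hTfin (N : ℕ) : {g : Γ | e g < N}.Finite := (Set.finite_Iio N).preimage he.injOn
  let T : ℕ → Finset Γ := fun N => (hTfin N).toFinset
  let p : ℕ → Γ →₀ LInf μ := fun N => Finsupp.indicator (T N) fun g _ => c g
  have hpmem {N g} (hg : g ∈ T N) : p N g = c g := Finsupp.indicator_of_mem hg _
  have hp0 (N g) : 0 ≤ p N g := by
    by_cases hg : g ∈ T N
    · rw [hpmem hg]
      exact hc0 g
    · exact (Finsupp.indicator_of_notMem hg _).ge
  have hpsupp (N) : (p N).support ⊆ T N := Finsupp.support_indicator_subset _ _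
  -- The support of `p N` can be smaller than `T N`, as some `c g` may be the zero class; the extra
  -- terms vanish wherever the representative of zero does.
  have hpsum (N : ℕ) (x : X) (hx0 : ∀ g, (p N g = 0) → p N g x = 0) (w : Γ → ℂ) :
      ∑ g ∈ (p N).support, p N g x * w g = ∑ g ∈ T N, c g x * w g := by
    rw [Finset.sum_subset (hpsupp N)]
    · exact Finset.sum_congr rfl fun g hg => by rw [hpmem hg]
    · intro g _ hg
      rw [hx0 g (Finsupp.notMem_support_iff.1 hg), zero_mul]
  have hpzero (N : ℕ) : ∀ᵐ x ∂μ, ∀ g, (p N g = 0) → p N g x = 0 := by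
    filter_upwards [Lp.coeFn_zero ℂ ∞ μ] with x hx g hg
    rw [hg, hx]
    rfl
  have hswap (N : ℕ) (x : X) (w : Γ → ℂ)
      (hx : ∀ g, c g x = ∑ k ∈ s.range, q k x * if x ∈ firstHit s e k g then 1 else 0) :
      ∑ g ∈ T N, c g x * w g
        = ∑ k ∈ s.range, q k x * ∑ g ∈ T N with x ∈ firstHit s e k g, w g := by
    simp only [hx, Finset.sum_mul, Finset.mul_sum, Finset.sum_filter]
    rw [Finset.sum_comm]
    refine Finset.sum_congr rfl fun k _ => Finset.sum_congr rfl fun g _ => ?_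
    split_ifs <;> simp
  have htot (N) : total (p N) ≤ linfOne μ := by
    rw [le_iff]
    filter_upwards [coeFn_total (p N), hpzero N, hc, coeFn_linfOne μ, hqsum, hq0']
      with x h2 h3 h4 h5 h6 h7
    have h8 := (hpsum N x h3 fun _ => 1).trans (hswap N x (fun _ => 1) h4)
    simp only [mul_one] at h8
    rw [h2, h8, h5]
    -- For fixed `x` and `k` there is at most one first hit, so each weight `q k x` is counted at
    -- most once.
    refine (Finset.sum_le_sum fun k hk => mul_le_of_le_one_right (h7 k hk) ?_).trans h6.le
    rw [Finset.sum_const, nsmul_one]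
    have : (Finset.card {g ∈ T N | x ∈ firstHit s e k g}) ≤ 1 :=
      Finset.card_le_one.2 fun g hg g' hg' =>
        firstHit_unique he (Finset.mem_filter.1 hg).2 (Finset.mem_filter.1 hg').2
    exact_mod_cast this
  -- pointwise convergence
  have hpt (f : F) : ∀ᵐ x ∂μ, ∀ᶠ N in atTop, ‖(pairing (p N) f - P f : LInf μ) x‖ ≤ 2 * δ := by
    have hpair : ∀ᵐ x ∂μ, ∀ N, pairing (p N) f x
        = ∑ k ∈ s.range, q k x *
          ∑ g ∈ T N with x ∈ firstHit s e k g, (f : LInf (prodMeasure Γ μ)) (g, x) := by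
      rw [ae_all_iff]
      intro N
      filter_upwards [coeFn_pairing (p N) (f : LInf (prodMeasure Γ μ)), hpzero N, hc]
        with x h2 h3 h4
      rw [h2, hpsum N x h3, hswap N x _ h4]
    have hsub : ∀ᵐ x ∂μ, ∀ N, (pairing (p N) f - P f : LInf μ) x = pairing (p N) f x - P f x :=
      ae_all_iff.2 fun N => Lp.coeFn_sub _ _
    have hsm : ∀ᵐ x ∂μ, ∀ k ∈ s.range, (k f • q k : LInf μ) x = k f * q k x := by
      rw [Filter.eventually_all_finset]
      exact fun k _ => Lp.coeFn_smul _ _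
    filter_upwards [hpair, hsub, hsm, ae_norm_le_norm (P f - ∑ k ∈ s.range, k f • q k),
      Lp.coeFn_sub (P f) (∑ k ∈ s.range, k f • q k),
      coeFn_finset_sum s.range fun k => k f • q k, hqsum, hq0', hqzero,
      ae_all_iff.2 fun g => (qmp_section μ g).ae hs] with x h2 h3 h4 h5 h6 h7 h8 h9 h10 h11
    -- Once `T N` contains the first hit `g` of `k`, the inner sum is the single value `f (g, x)`,
    -- which is within `δ` of `k f`. If there is no hit, the weight is zero.
    have hev : ∀ᶠ N in atTop, ∀ k ∈ s.range,
        ‖q k x * ∑ g ∈ T N with x ∈ firstHit s e k g, (f : LInf (prodMeasure Γ μ)) (g, x)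
          - k f * q k x‖ ≤ (q k x).re * δ := by
      rw [Filter.eventually_all_finset]
      intro k hk
      have hre : q k x = ((q k x).re : ℂ) :=
        Complex.ext rfl (by simpa using (Complex.le_def.1 (h9 k hk)).2.symm)
      by_cases hhit : ∃ g, s (g, x) = k
      · obtain ⟨g, hg⟩ := exists_mem_firstHit e hhit
        filter_upwards [eventually_gt_atTop (e g)] with N hN
        have hfil : ({g ∈ T N | x ∈ firstHit s e k g} : Finset Γ) = {g} := by
          ext g'
          rw [Finset.mem_filter, Finset.mem_singleton]
          constructor
          · exact fun h => firstHit_unique he h.2 hg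
          · rintro rfl
            exact ⟨(hTfin N).mem_toFinset.2 hN, hg⟩
        rw [hfil, Finset.sum_singleton, mul_comm (k f), ← mul_sub, norm_mul]
        have h12 := h11 g f
        rw [hg.1] at h12
        conv_lhs => rw [hre]
        rw [Complex.norm_real, Real.norm_of_nonneg (Complex.le_def.1 (h9 k hk)).1]
        gcongr
        exact (Complex.le_def.1 (h9 k hk)).1
      · refine Eventually.of_forall fun N => ?_
        rw [h10 k hk (not_exists.1 hhit)]
        simp
    filter_upwards [hev] with N hN
    have h12 : ‖pairing (p N) f x - ∑ k ∈ s.range, k f * q k x‖ ≤ δ := by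
      rw [h2, ← Finset.sum_sub_distrib]
      refine (norm_sum_le_of_le _ hN).trans ?_
      rw [← Finset.sum_mul, ← Complex.re_sum, h8, Complex.one_re, one_mul]
    have h13 : ‖P f x - ∑ k ∈ s.range, k f * q k x‖ ≤ δ := by
      rw [← Finset.sum_congr rfl h4, ← h7, ← Pi.sub_apply, ← h6]
      exact h5.trans (happ f)
    rw [h3]
    calc ‖pairing (p N) f x - P f x‖
        = ‖(pairing (p N) f x - ∑ k ∈ s.range, k f * q k x)
          - (P f x - ∑ k ∈ s.range, k f * q k x)‖ := by rw [sub_sub_sub_cancel_right]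
      _ ≤ δ + δ := (norm_sub_le _ _).trans (add_le_add h12 h13)
      _ = 2 * δ := (two_mul δ).symm
  -- convergence in mean
  have hmean (f : F) : ∀ᶠ N in atTop, ∫ x, ‖(pairing (p N) f - P f : LInf μ) x‖ ∂μ ≤ ε := by
    set D : ℕ → LInf μ := fun N => pairing (p N) f - P f
    have hDm (N) : AEStronglyMeasurable (fun x => max (‖D N x‖ - 2 * δ) 0) μ :=
      (((measurable_coeFn (D N)).norm.sub_const _).max measurable_const).aestronglyMeasurable
    have hDb (N) : ‖D N‖ ≤ 2 * ‖(f : LInf (prodMeasure Γ μ))‖ := by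
      have h2 := norm_pairing_le zero_le_one (ae_sum_norm_le_one (hp0 N) (htot N))
        (f : LInf (prodMeasure Γ μ))
      have h3 := hcontr f
      have h4 := norm_sub_le (pairing (p N) f) (P f)
      change ‖pairing (p N) f - P f‖ ≤ _
      linarith
    have hDb' (N) : ∀ᵐ x ∂μ,
        ‖max (‖D N x‖ - 2 * δ) 0‖ ≤ 2 * ‖(f : LInf (prodMeasure Γ μ))‖ := by
      filter_upwards [ae_norm_le_norm (D N)] with x hx
      rw [Real.norm_of_nonneg (le_max_right _ _)]
      refine max_le ?_ (by positivity)
      linarith [hDb N]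
    -- The index from which `‖D N x‖ ≤ 2 * δ` depends on `x`; dominated convergence is therefore
    -- applied to the excess over `2 * δ`, which is eventually zero at almost every point.
    have hlim : Tendsto (fun N => ∫ x, max (‖D N x‖ - 2 * δ) 0 ∂μ) atTop (𝓝 (∫ _, 0 ∂μ)) := by
      refine tendsto_integral_of_dominated_convergence _ hDm (integrable_const _) hDb' ?_
      filter_upwards [hpt f] with x hx
      refine tendsto_const_nhds.congr' ?_
      filter_upwards [hx] with N hN
      rw [max_eq_right]
      linarith
    rw [integral_zero] at hlim
    filter_upwards [hlim.eventually_le_const hδ] with N hN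
    have hint : Integrable (fun x => max (‖D N x‖ - 2 * δ) 0) μ :=
      Integrable.of_bound (hDm N) _ (hDb' N)
    have hint' : Integrable (fun x => ‖D N x‖) μ :=
      Integrable.of_bound (measurable_coeFn (D N)).norm.aestronglyMeasurable ‖D N‖ (by
        simpa using ae_norm_le_norm (D N))
    calc ∫ x, ‖D N x‖ ∂μ ≤ ∫ x, (max (‖D N x‖ - 2 * δ) 0 + 2 * δ) ∂μ := by
          refine integral_mono hint' (hint.add (integrable_const _)) fun x => ?_
          have := le_max_left (‖D N x‖ - 2 * δ) 0
          change ‖D N x‖ ≤ max (‖D N x‖ - 2 * δ) 0 + 2 * δ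
          linarith
      _ = ∫ x, max (‖D N x‖ - 2 * δ) 0 ∂μ + 2 * δ := by
          rw [integral_add hint (integrable_const _)]
          simp
      _ ≤ ε := by
          simp only [δ] at hN ⊢
          linarith
  obtain ⟨N, hN⟩ := (Filter.eventually_all.2 hmean).exists
  exact ⟨p N, hp0 N, htot N, fun f hf => hN ⟨f, hf⟩⟩

variable [QuasiInvariant Γ μ]

/-- A positive equivariant conditional expectation is a limit of finitely supported maps. -/
theorem exists_isApproximatelyInvariant (P : LInf (prodMeasure Γ μ) →ₗ[ℂ] LInf μ)
    (hP : IsPositive P) (h1 : IsUnital P) (hm : IsModuleMap P) (he : IsEquivariant P) :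
    ∃ (I : Type (max u v)) (_ : Preorder I) (_ : IsDirectedOrder I) (_ : Nonempty I)
      (p : I → Γ →₀ LInf μ), IsApproximatelyInvariant p ∧
        (∀ i g, 0 ≤ p i g) ∧ ∀ i, total (p i) ≤ linfOne μ := by
  classical
  -- The net is indexed by a finite set of functions together with a precision `1 / (n + 1)`.
  choose p hp0 htot hmean using fun i : Finset (LInf (prodMeasure Γ μ)) × ℕ =>
    exists_finsupp_approx P hP h1 hm i.1 (ε := 1 / ((i.2 : ℝ) + 1)) (by positivity)
  have hlim (f : LInf (prodMeasure Γ μ)) :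
      UltraweakTendsto (fun i => pairing (p i) f) atTop (P f) := by
    -- Approximation in mean suffices because, for a bounded net, the test functions may be taken
    -- simple, hence bounded.
    refine ultraweakTendsto_of_bounded
      (fun i => norm_pairing_le zero_le_one (ae_sum_norm_le_one (hp0 i) (htot i)) f) fun ψ => ?_
    obtain ⟨C, hC⟩ := ψ.exists_forall_norm_le
    have hψ : Integrable ψ μ := ψ.integrable_of_isFiniteMeasure
    have h2 : Tendsto (fun i : Finset (LInf (prodMeasure Γ μ)) × ℕ => |C| * (1 / ((i.2 : ℝ) + 1)))
        atTop (𝓝 0) := by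
      have h3 : Tendsto (fun i : Finset (LInf (prodMeasure Γ μ)) × ℕ => i.2) atTop atTop := by
        rw [← prod_atTop_atTop_eq]
        exact tendsto_snd
      simpa using (tendsto_one_div_add_atTop_nhds_zero_nat.comp h3).const_mul |C|
    rw [tendsto_iff_norm_sub_tendsto_zero]
    refine squeeze_zero' (Eventually.of_forall fun _ => norm_nonneg _) ?_ h2
    filter_upwards [eventually_ge_atTop (({f}, 0) : Finset (LInf (prodMeasure Γ μ)) × ℕ)]
      with i hi
    have hf : f ∈ i.1 := hi.1 (Finset.mem_singleton_self f)
    rw [← integral_sub (integrable_coeFn_mul _ hψ) (integrable_coeFn_mul _ hψ)]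
    refine le_trans ?_ (mul_le_mul_of_nonneg_left (hmean i f hf) (abs_nonneg C))
    rw [← integral_const_mul]
    have hint : Integrable (fun x => ‖(pairing (p i) f - P f : LInf μ) x‖) μ := by
      refine Integrable.norm ?_
      simpa using integrable_coeFn_mul (pairing (p i) f - P f) (integrable_const (1 : ℂ))
    refine norm_integral_le_of_norm_le (hint.const_mul _) ?_
    filter_upwards [Lp.coeFn_sub (pairing (p i) f) (P f)] with x hx
    rw [hx, Pi.sub_apply, ← sub_mul, norm_mul, mul_comm]
    gcongr
    exact (hC x).trans (le_abs_self C)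
  refine ⟨Finset (LInf (prodMeasure Γ μ)) × ℕ, inferInstance, inferInstance, inferInstance, p,
    ⟨⟨1, fun i => ae_sum_norm_le_one (hp0 i) (htot i)⟩, ?_, fun f h => ?_⟩, hp0, htot⟩
  · simpa only [total_eq_pairing_one, h1.symm] using hlim (linfOne _)
  -- The limit is `h.P(h⁻¹.f) - P f`, which vanishes by equivariance.
  · have h2 := ((hlim (actProd μ h⁻¹ f)).act h).sub (hlim f)
    rw [he, act_act_inv, sub_self] at h2
    simpa only [pairing_sub_left, pairing_actFin] using h2

end Approximation

end

end MeasuredAction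

/-! ### The cycle of implications. -/

theorem mainTheorem6 {Γ : Type u} {X : Type v} [Group Γ] [Countable Γ] [MeasurableSpace Γ]
    [DiscreteMeasurableSpace Γ] [MeasurableSpace X] [StandardBorelSpace X] [MulAction Γ X]
    [MeasurableConstSMul Γ X] (μ : Measure X) [IsProbabilityMeasure μ]
    [MeasuredAction.QuasiInvariant Γ μ] :
    List.TFAE [
      (∃ P : MeasuredAction.LInf (MeasuredAction.prodMeasure Γ μ) →L[ℂ] MeasuredAction.LInf μ,
        MeasuredAction.IsUnital P ∧ MeasuredAction.IsModuleMap P ∧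
          MeasuredAction.IsEquivariant P),
      (∃ P : MeasuredAction.LInf (MeasuredAction.prodMeasure Γ μ) →L[ℂ] MeasuredAction.LInf μ,
        MeasuredAction.IsStarPreserving P ∧ MeasuredAction.IsUnital P ∧
          MeasuredAction.IsModuleMap P ∧ MeasuredAction.IsEquivariant P),
      (∃ (I : Type (max u v)) (_ : Preorder I) (_ : IsDirectedOrder I) (_ : Nonempty I)
        (p : I → Γ →₀ MeasuredAction.LInf μ), MeasuredAction.IsApproximatelyInvariant p),
      (∃ (I : Type (max u v)) (_ : Preorder I) (_ : IsDirectedOrder I) (_ : Nonempty I)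
        (p : I → Γ →₀ MeasuredAction.LInf μ), MeasuredAction.IsApproximatelyInvariant p ∧
          (∀ i g, 0 ≤ p i g) ∧ ∀ i, MeasuredAction.total (p i) ≤ MeasuredAction.linfOne μ),
      (∃ P : MeasuredAction.LInf (MeasuredAction.prodMeasure Γ μ) →ₗ[ℂ] MeasuredAction.LInf μ,
        MeasuredAction.IsPositive P ∧ MeasuredAction.IsUnital P ∧
          MeasuredAction.IsModuleMap P ∧ MeasuredAction.IsEquivariant P)] ∧
    (∀ P : MeasuredAction.LInf (MeasuredAction.prodMeasure Γ μ) →ₗ[ℂ] MeasuredAction.LInf μ,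
      MeasuredAction.IsPositive P → MeasuredAction.IsUnital P → MeasuredAction.IsModuleMap P →
        MeasuredAction.IsConditionalExpectation P) := by
  refine ⟨?_, MeasuredAction.isConditionalExpectation_of_isPositive⟩
  tfae_have 1 → 2 := fun ⟨P, h1, hm, he⟩ => MeasuredAction.exists_isStarPreserving P h1 hm he
  tfae_have 2 → 5 := fun ⟨P, hs, h1, hm, he⟩ => MeasuredAction.exists_isPositive P hs h1 hm he
  tfae_have 5 → 4 := fun ⟨P, hP, h1, hm, he⟩ =>
    MeasuredAction.exists_isApproximatelyInvariant P hP h1 hm he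
  tfae_have 4 → 3 := fun ⟨I, i1, i2, i3, p, hp, _⟩ => ⟨I, i1, i2, i3, p, hp⟩
  tfae_have 3 → 1 := fun ⟨_, _, _, _, _, hp⟩ =>
    MeasuredAction.exists_equivariant_of_isApproximatelyInvariant hp
  tfae_finish
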